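/- Let $n,d\ge 1$ be integers, and let $D_n$ be the finite group of orthogonal transformations of $\mathbb{R}^n$ generated by the reflections at the hyperplanes $\{X_i=X_j\}$ and $\{X_i=-X_j\}$ for $1\le i<j\le n$. It acts on $\mathbb{R}[X_1,\dots,X_n]$ by $(\sigma f)(X)=f(\sigma^{-1}X)$. Let $\mathcal{P}_{n,2d}^{D_n}$ be the cone of all $D_n$-invariant real forms $f$ of degree $2d$ in $n$ variables with $f(x)\ge 0$ for all $x\in\mathbb{R}^n$, and let $\Sigma_{n,2d}^{D_n}$ be the cone of all $D_n$-invariant real forms of degree $2d$ in $n$ variables that can be written as $f_1^2+\dots+f_m^2$ with real forms $f_1,\dots,f_m$. (The zero polynomial counts as a form of every degree.) Then $$\Sigma_{n,2d}^{D_n}=\mathcal{P}_{n,2d}^{D_n}\quad\Longleftrightarrow\quad n\le 2,\ \text{ or }\ 2d=2,\ \text{ or }\ 2d=4,\ \text{ or }\ (n,2d)=(3,8).$$ In particular, for $n\ge 3$ the two cones coincide if and only if $(n,2d)\in\{(n,2),(n,4),(3,8)\}$. -/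

import Mathlib

open MvPolynomial

/-- The reflection group of type `D_n` acting on Euclidean `ℝⁿ`: the group generated by the
orthogonal reflections at the hyperplanes `X_i = X_j` and `X_i = -X_j`, for `i < j`. -/
noncomputable def reflectionGroupD (n : ℕ) :
    Subgroup (EuclideanSpace ℝ (Fin n) ≃ₗᵢ[ℝ] EuclideanSpace ℝ (Fin n)) :=
  Subgroup.closure
    {g | ∃ i j : Fin n, i < j ∧
      (g = (Submodule.span ℝ
              {EuclideanSpace.single i (1 : ℝ) - EuclideanSpace.single j (1 : ℝ)})ᗮ.reflection ∨
       g = (Submodule.span ℝ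
              {EuclideanSpace.single i (1 : ℝ) + EuclideanSpace.single j (1 : ℝ)})ᗮ.reflection)}

/-- The induced action on polynomials, `(σ f)(X) = f(σ⁻¹ X)`: the variable `X_i` is replaced by the
linear form `∑ j, (σ⁻¹ e_j)_i X_j`, which is the `i`-th coordinate of `σ⁻¹ X`. -/
noncomputable def polyAction {n : ℕ}
    (σ : EuclideanSpace ℝ (Fin n) ≃ₗᵢ[ℝ] EuclideanSpace ℝ (Fin n)) :
    MvPolynomial (Fin n) ℝ →ₐ[ℝ] MvPolynomial (Fin n) ℝ :=
  aeval fun i => ∑ j, C ((σ⁻¹ (EuclideanSpace.single j (1 : ℝ))) i) * X j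

/-- `f` is fixed by every element of the group `G`. -/
def IsInvariantUnder {n : ℕ}
    (G : Subgroup (EuclideanSpace ℝ (Fin n) ≃ₗᵢ[ℝ] EuclideanSpace ℝ (Fin n)))
    (f : MvPolynomial (Fin n) ℝ) : Prop :=
  ∀ σ ∈ G, polyAction σ f = f

/-- `f = f₁² + ⋯ + f_m²` for some real forms (homogeneous polynomials) `f₁, …, f_m`. -/
def IsSumOfSquaresOfForms {n : ℕ} (f : MvPolynomial (Fin n) ℝ) : Prop :=
  ∃ (m : ℕ) (q : Fin m → MvPolynomial (Fin n) ℝ),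
    (∀ k, ∃ e : ℕ, (q k).IsHomogeneous e) ∧ f = ∑ k, q k ^ 2

/-- `f` takes only non-negative values on `ℝⁿ`. -/
def IsNonnegative {n : ℕ} (f : MvPolynomial (Fin n) ℝ) : Prop :=
  ∀ x : Fin n → ℝ, 0 ≤ eval x f

/-- The cone of `G`-invariant sums of squares forms of degree `k` in `n` variables. -/
def invariantSOSCone (n k : ℕ)
    (G : Subgroup (EuclideanSpace ℝ (Fin n) ≃ₗᵢ[ℝ] EuclideanSpace ℝ (Fin n))) :
    Set (MvPolynomial (Fin n) ℝ) :=
  {f | f.IsHomogeneous k ∧ IsInvariantUnder G f ∧ IsSumOfSquaresOfForms f}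

/-- The cone of `G`-invariant non-negative forms of degree `k` in `n` variables. -/
def invariantNonnegCone (n k : ℕ)
    (G : Subgroup (EuclideanSpace ℝ (Fin n) ≃ₗᵢ[ℝ] EuclideanSpace ℝ (Fin n))) :
    Set (MvPolynomial (Fin n) ℝ) :=
  {f | f.IsHomogeneous k ∧ IsInvariantUnder G f ∧ IsNonnegative f}

/-! Failure for `n ≥ 3`. Suppose a non-negative form is a sum of squares `∑ h²`. Then every `h`
vanishes at all its real zeros. Forms of the low degree of `h` satisfy a linear relation between
their values at suitably chosen zeros and at one further point, so every `h` vanishes there too,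
although the form is positive there (`eval_cons_one_zero_eq_zero`, `eval_single_eq_zero`). This
applies to forms built from `evenSextic` (non-negative by `symmetricCubic_nonneg`), `ternaryDecic`
and `evenVariance`, in degrees 6, 8, 10 and 12; for `n = 3`, degree 8 is replaced by 16. All larger
degrees follow by multiplying with the square of `indefiniteQuartic`, which raises the degree by 8.
That quartic divides every polynomial vanishing on its real zeros, so its square can be cancelled
from a sum of squares (`IsSOSOfDegree.of_sq_mul`).

Equality. For `n ≤ 2` every non-negative form is a sum of squares, by factoring univariate
polynomials. In degrees 2 and 4 with `n ≥ 3` the invariant forms are spanned by at most three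
explicit ones, and non-negativity at a few points expresses the form through explicit sums of
squares.

For ternary octics put `S = x² + y² + z²`, let `W` be `squareSpread` and let `T` be half the product
of the three `squareDeviation`s. With `S` normalised to 1, an invariant octic is `g₀ + g₂ W + g₃ T +
g₄ W²`. On points with two equal squares `W = w²` and `T = w³`, which gives a quartic in `w` without
linear term. On points with one zero coordinate `T = (3 W - 1) / 2`, which gives a quadratic in `W`.
Non-negativity on these two curves already suffices: subtracting known sums of squares until the
quartic touches zero leaves a form with so few free parameters that it is a combination of explicit
squares. -/

/-- `f` is a finite sum of squares of homogeneous polynomials, all of degree `d`. -/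
def IsSOSOfDegree {τ : Type*} (d : ℕ) (f : MvPolynomial τ ℝ) : Prop :=
  ∃ (ι : Type) (_ : Fintype ι) (q : ι → MvPolynomial τ ℝ),
    (∀ k, (q k).IsHomogeneous d) ∧ f = ∑ k, q k ^ 2

/-! ### Sums of squares of forms of one fixed degree. -/

namespace IsSOSOfDegree

variable {τ : Type*} {d e : ℕ} {f g : MvPolynomial τ ℝ}

theorem sq (h : f.IsHomogeneous d) : IsSOSOfDegree d (f ^ 2) :=
  ⟨Unit, inferInstance, fun _ => f, fun _ => h, by simp⟩

theorem zero : IsSOSOfDegree d (0 : MvPolynomial τ ℝ) :=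
  ⟨Empty, inferInstance, fun _ => 0, fun k => k.elim, by simp⟩

theorem add (hf : IsSOSOfDegree d f) (hg : IsSOSOfDegree d g) : IsSOSOfDegree d (f + g) := by
  obtain ⟨ι, _, q, hq, rfl⟩ := hf
  obtain ⟨κ, _, r, hr, rfl⟩ := hg
  refine ⟨ι ⊕ κ, inferInstance, Sum.elim q r, ?_, by simp⟩
  rintro (k | k)
  · exact hq k
  · exact hr k

theorem sum {α : Type*} (s : Finset α) (F : α → MvPolynomial τ ℝ)
    (h : ∀ a ∈ s, IsSOSOfDegree d (F a)) : IsSOSOfDegree d (∑ a ∈ s, F a) := by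
  classical
  induction s using Finset.induction_on with
  | empty => simpa using zero
  | insert a s ha ih =>
    rw [Finset.sum_insert ha]
    exact (h a (Finset.mem_insert_self _ _)).add
      (ih fun b hb => h b (Finset.mem_insert_of_mem hb))

theorem mul (hf : IsSOSOfDegree d f) (hg : IsSOSOfDegree e g) :
    IsSOSOfDegree (d + e) (f * g) := by
  obtain ⟨ι, _, q, hq, rfl⟩ := hf
  obtain ⟨κ, _, r, hr, rfl⟩ := hg
  refine ⟨ι × κ, inferInstance, fun p => q p.1 * r p.2, fun p => (hq p.1).mul (hr p.2), ?_⟩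
  rw [Finset.sum_mul_sum, Fintype.sum_prod_type]
  simp only [mul_pow]

theorem C_mul {c : ℝ} (hc : 0 ≤ c) (hf : IsSOSOfDegree d f) : IsSOSOfDegree d (C c * f) := by
  have h : IsSOSOfDegree 0 (C (Real.sqrt c) ^ 2 : MvPolynomial τ ℝ) := sq (isHomogeneous_C _ _)
  rw [← map_pow, Real.sq_sqrt hc] at h
  simpa using h.mul hf

theorem eval_nonneg (hf : IsSOSOfDegree d f) (x : τ → ℝ) : 0 ≤ eval x f := by
  obtain ⟨ι, _, q, -, rfl⟩ := hf
  simp only [map_sum, map_pow]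
  positivity

theorem isSumOfSquaresOfForms {n : ℕ} {f : MvPolynomial (Fin n) ℝ} (hf : IsSOSOfDegree d f) :
    IsSumOfSquaresOfForms f := by
  obtain ⟨ι, _, q, hq, rfl⟩ := hf
  refine ⟨Fintype.card ι, fun k => q ((Fintype.equivFin ι).symm k), fun k => ⟨d, hq _⟩, ?_⟩
  exact ((Fintype.equivFin ι).symm.sum_comp fun k => q k ^ 2).symm

/-- Squares of forms of degree other than `d` do not meet the component of degree `2 * d`, so those
summands can be replaced by zero. -/
theorem of_isSumOfSquaresOfForms {n : ℕ} {f : MvPolynomial (Fin n) ℝ}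
    (hf : f.IsHomogeneous (2 * d)) (h : IsSumOfSquaresOfForms f) : IsSOSOfDegree d f := by
  classical
  obtain ⟨m, q, hq, hfq⟩ := h
  choose e he using hq
  refine ⟨Fin m, inferInstance, fun k => if e k = d then q k else 0, fun k => ?_, ?_⟩
  · dsimp only
    split_ifs with hk
    · exact hk ▸ he k
    · exact isHomogeneous_zero _ _ _
  · have h1 := homogeneousComponent_eq_self hf
    rw [← h1]
    conv_lhs => rw [hfq, map_sum]
    refine Finset.sum_congr rfl fun k _ => ?_
    have h2 : (q k ^ 2).IsHomogeneous (2 * e k) := by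
      simpa [mul_comm] using (he k).pow 2
    rw [homogeneousComponent_of_mem h2]
    by_cases hk : e k = d
    · simp [hk]
    · have : ¬ (2 * d = 2 * e k) := by omega
      simp [hk, this]

end IsSOSOfDegree

/-! ### Cancelling a square factor from a sum of squares. -/

theorem MvPolynomial.IsHomogeneous.exists_isHomogeneous_eq_mul {τ : Type*} {a b : ℕ}
    {g h : MvPolynomial τ ℝ} (hg : g.IsHomogeneous a) (hgh : h.IsHomogeneous (a + b))
    (hd : g ∣ h) : ∃ h' : MvPolynomial τ ℝ, h'.IsHomogeneous b ∧ h = g * h' := by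
  classical
  obtain ⟨h', rfl⟩ := hd
  refine ⟨homogeneousComponent b h', homogeneousComponent_isHomogeneous _ _, ?_⟩
  rw [← homogeneousComponent_eq_self hgh]
  conv_lhs => rw [← sum_homogeneousComponent h', Finset.mul_sum, map_sum]
  have : ∀ i, homogeneousComponent (a + b) (g * homogeneousComponent i h') =
      if i = b then g * homogeneousComponent b h' else 0 := by
    intro i
    rw [homogeneousComponent_of_mem (hg.mul (homogeneousComponent_isHomogeneous i h'))]
    by_cases hi : i = b
    · simp [hi]
    · simp [hi, Ne.symm hi]
  simp only [this]
  rw [Finset.sum_ite_eq']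
  split_ifs with hb
  · rfl
  · rw [Finset.mem_range, not_lt] at hb
    rw [homogeneousComponent_eq_zero _ _ (by omega), mul_zero]

/-- A polynomial `g` that divides every polynomial vanishing on its real zeros. -/
def IsRealPrincipal {τ : Type*} (g : MvPolynomial τ ℝ) : Prop :=
  ∀ h : MvPolynomial τ ℝ, (∀ x, eval x g = 0 → eval x h = 0) → g ∣ h

/-- At a real zero of `g` the sum of the `q k ^ 2` vanishes, hence each `q k` does. So `g` divides
every `q k`, and `g ^ 2` cancels. -/
theorem IsSOSOfDegree.of_sq_mul {τ : Type*} {a d : ℕ} {f g : MvPolynomial τ ℝ}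
    (hr : IsRealPrincipal g) (hg : g.IsHomogeneous a) (hg0 : g ≠ 0)
    (h : IsSOSOfDegree (a + d) (g ^ 2 * f)) : IsSOSOfDegree d f := by
  obtain ⟨ι, _, q, hq, hf⟩ := h
  have hz : ∀ k, g ∣ q k := by
    intro k
    refine hr _ fun x hx => ?_
    have h1 := congrArg (eval x) hf
    simp only [map_mul, map_pow, hx, map_sum] at h1
    have h2 : ∑ k, eval x (q k) ^ 2 = 0 := by rw [← h1]; ring
    rw [Finset.sum_eq_zero_iff_of_nonneg (fun i _ => sq_nonneg _)] at h2
    exact pow_eq_zero_iff (two_ne_zero) |>.1 (h2 k (Finset.mem_univ _))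
  choose r hr1 hr2 using fun k => hg.exists_isHomogeneous_eq_mul (hq k) (hz k)
  refine ⟨ι, inferInstance, r, hr1, ?_⟩
  have : g ^ 2 * f = g ^ 2 * ∑ k, r k ^ 2 := by
    rw [hf, Finset.mul_sum]
    exact Finset.sum_congr rfl fun k _ => by rw [hr2 k]; ring
  exact mul_left_cancel₀ (pow_ne_zero 2 hg0) this

theorem MvPolynomial.eval_aeval {σ τ : Type*} (x : τ → ℝ) (g : σ → MvPolynomial τ ℝ)
    (p : MvPolynomial σ ℝ) : eval x (aeval g p) = eval (fun i => eval x (g i)) p := by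
  induction p using MvPolynomial.induction_on with
  | C a => simp
  | add p q hp hq => rw [map_add, map_add, map_add, hp, hq]
  | mul_X p i hp => rw [map_mul, map_mul, map_mul, hp, aeval_X, eval_X]

/-- Modulo `X i`, a polynomial is congruent to its specialisation at `X i = 0`, which is zero
because it vanishes as a function. -/
theorem isRealPrincipal_X {τ : Type*} (i : τ) : IsRealPrincipal (X i : MvPolynomial τ ℝ) := by
  classical
  intro h hh
  let φ : MvPolynomial τ ℝ →ₐ[ℝ] MvPolynomial τ ℝ := aeval (Function.update X i 0)
  have h0 : φ h = 0 := by
    refine MvPolynomial.funext fun x => ?_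
    have h1 : eval x (φ h) = eval (Function.update x i 0) h := by
      rw [eval_aeval]
      congr 2
      funext j
      by_cases hj : j = i
      · subst hj; simp
      · simp [hj]
    rw [h1, map_zero]
    exact hh _ (by simp)
  let I := Ideal.span {(X i : MvPolynomial τ ℝ)}
  have h2 : (Ideal.Quotient.mkₐ ℝ I).comp φ = Ideal.Quotient.mkₐ ℝ I := by
    refine MvPolynomial.algHom_ext fun j => ?_
    by_cases hj : j = i
    · subst hj
      simp only [φ, AlgHom.comp_apply, aeval_X, Function.update_self, map_zero]
      symm
      exact Ideal.Quotient.eq_zero_iff_mem.2 (Ideal.mem_span_singleton_self _)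
    · simp [φ, hj]
  have h3 := congrArg (fun ψ => ψ h) h2
  simp only [AlgHom.comp_apply, h0, map_zero] at h3
  exact Ideal.mem_span_singleton.1 (Ideal.Quotient.eq_zero_iff_mem.1 h3.symm)

/-! ### The reflection group in coordinates, and its invariants. -/

theorem eval_polyAction {n : ℕ} (σ : EuclideanSpace ℝ (Fin n) ≃ₗᵢ[ℝ] EuclideanSpace ℝ (Fin n))
    (f : MvPolynomial (Fin n) ℝ) (x : EuclideanSpace ℝ (Fin n)) :
    eval (fun i => x i) (polyAction σ f) = eval (fun i => (σ⁻¹ x) i) f := by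
  rw [polyAction, eval_aeval]
  congr 2
  funext i
  have hx : x = ∑ j, x j • EuclideanSpace.single j (1 : ℝ) := by
    ext k; simp [Pi.single_apply]
  conv_rhs => rw [hx]
  simp [mul_comm]

theorem isInvariantUnder_iff {n : ℕ}
    (G : Subgroup (EuclideanSpace ℝ (Fin n) ≃ₗᵢ[ℝ] EuclideanSpace ℝ (Fin n)))
    (f : MvPolynomial (Fin n) ℝ) :
    IsInvariantUnder G f ↔
      ∀ σ ∈ G, ∀ x : EuclideanSpace ℝ (Fin n),
        eval (fun i => (σ x) i) f = eval (fun i => x i) f := by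
  constructor
  · intro h σ hσ x
    have h1 := h σ⁻¹ (G.inv_mem hσ)
    have h2 := eval_polyAction σ⁻¹ f x
    rw [h1, inv_inv] at h2
    exact h2.symm
  · intro h σ hσ
    refine MvPolynomial.funext fun x => ?_
    have h2 := eval_polyAction σ f (WithLp.toLp 2 x)
    have h3 := h σ⁻¹ (G.inv_mem hσ) (WithLp.toLp 2 x)
    exact h2.trans h3

theorem reflection_orthogonal_singleton_apply {E : Type*} [NormedAddCommGroup E]
    [InnerProductSpace ℝ E] (v x : E) :
    (Submodule.span ℝ {v})ᗮ.reflection x = x - (2 * (inner ℝ v x / ‖v‖ ^ 2)) • v := by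
  rw [Submodule.reflection_orthogonal_apply, Submodule.reflection_singleton_apply]
  simp only [RCLike.ofReal_real_eq_id, id_eq, two_smul, neg_sub, ← add_smul, ← two_mul]

theorem reflection_single_sub_apply {n : ℕ} {i j : Fin n} (hij : i ≠ j)
    (x : EuclideanSpace ℝ (Fin n)) (k : Fin n) :
    ((Submodule.span ℝ {EuclideanSpace.single i (1 : ℝ) -
      EuclideanSpace.single j (1 : ℝ)})ᗮ.reflection x) k = x (Equiv.swap i j k) := by
  rw [reflection_orthogonal_singleton_apply]
  have h1 : ‖EuclideanSpace.single i (1 : ℝ) - EuclideanSpace.single j (1 : ℝ)‖ ^ 2 = 2 := by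
    rw [← real_inner_self_eq_norm_sq]
    simp only [inner_sub_left, inner_sub_right, EuclideanSpace.inner_single_left]
    simp [hij, hij.symm]
    norm_num
  have h2 : inner ℝ (EuclideanSpace.single i (1 : ℝ) - EuclideanSpace.single j (1 : ℝ)) x
      = x i - x j := by
    simp [inner_sub_left, EuclideanSpace.inner_single_left]
  rw [h1, h2]
  by_cases hi : k = i
  · subst hi; simp [hij]; ring
  · by_cases hj : k = j
    · subst hj; simp [hi]; ring
    · simp [hi, hj, Equiv.swap_apply_of_ne_of_ne hi hj]

theorem reflection_single_add_apply {n : ℕ} {i j : Fin n} (hij : i ≠ j)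
    (x : EuclideanSpace ℝ (Fin n)) (k : Fin n) :
    ((Submodule.span ℝ {EuclideanSpace.single i (1 : ℝ) +
      EuclideanSpace.single j (1 : ℝ)})ᗮ.reflection x) k =
      (if k = i ∨ k = j then -1 else 1) * x (Equiv.swap i j k) := by
  rw [reflection_orthogonal_singleton_apply]
  have h1 : ‖EuclideanSpace.single i (1 : ℝ) + EuclideanSpace.single j (1 : ℝ)‖ ^ 2 = 2 := by
    rw [← real_inner_self_eq_norm_sq]
    simp only [inner_add_left, inner_add_right, EuclideanSpace.inner_single_left]
    simp [hij, hij.symm]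
    norm_num
  have h2 : inner ℝ (EuclideanSpace.single i (1 : ℝ) + EuclideanSpace.single j (1 : ℝ)) x
      = x i + x j := by
    simp [inner_add_left, EuclideanSpace.inner_single_left]
  rw [h1, h2]
  by_cases hi : k = i
  · subst hi; simp [hij]; ring
  · by_cases hj : k = j
    · subst hj; simp [hi]; ring
    · simp [hi, hj, Equiv.swap_apply_of_ne_of_ne hi hj]

theorem sum_even_pow_reflectionGroupD {n : ℕ}
    {σ : EuclideanSpace ℝ (Fin n) ≃ₗᵢ[ℝ] EuclideanSpace ℝ (Fin n)}
    (hσ : σ ∈ reflectionGroupD n) (r : ℕ) (x : EuclideanSpace ℝ (Fin n)) :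
    ∑ i, (σ x) i ^ (2 * r) = ∑ i, x i ^ (2 * r) := by
  induction hσ using Subgroup.closure_induction generalizing x with
  | mem g hg =>
    obtain ⟨i, j, hij, h⟩ := hg
    rw [← Equiv.sum_comp (Equiv.swap i j) fun k => x k ^ (2 * r)]
    refine Finset.sum_congr rfl fun k _ => ?_
    rcases h with rfl | rfl
    · rw [reflection_single_sub_apply hij.ne]
    · rw [reflection_single_add_apply hij.ne, pow_mul, pow_mul, mul_pow]
      split_ifs <;> norm_num
  | one => rfl
  | mul a b _ _ ha hb => rw [LinearIsometryEquiv.coe_mul, Function.comp_apply, ha, hb]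
  | inv a _ ha =>
    rw [← ha (a⁻¹ x)]
    congr 1
    have : a (a⁻¹ x) = x := a.apply_symm_apply x
    rw [this]

theorem eval_psum {n : ℕ} (k : ℕ) (x : Fin n → ℝ) :
    eval x (psum (Fin n) ℝ k) = ∑ i, x i ^ k := by
  simp [psum]

theorem isHomogeneous_psum (n k : ℕ) : (psum (Fin n) ℝ k).IsHomogeneous k :=
  IsHomogeneous.sum _ _ _ fun i _ => isHomogeneous_X_pow i k

theorem IsInvariantUnder.psum_two_mul (n r : ℕ) :
    IsInvariantUnder (reflectionGroupD n) (psum (Fin n) ℝ (2 * r)) := by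
  rw [isInvariantUnder_iff]
  intro σ hσ x
  rw [eval_psum, eval_psum, sum_even_pow_reflectionGroupD hσ]

section Invariant

variable {n : ℕ} {f : MvPolynomial (Fin n) ℝ}

theorem IsInvariantUnder.eval_swap (hf : IsInvariantUnder (reflectionGroupD n) f)
    {i j : Fin n} (hij : i ≠ j) (x : Fin n → ℝ) :
    eval (fun k => x (Equiv.swap i j k)) f = eval x f := by
  wlog h : i < j generalizing i j
  · rw [Equiv.swap_comm]
    exact this hij.symm (lt_of_le_of_ne (not_lt.1 h) hij.symm)
  rw [isInvariantUnder_iff] at hf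
  have h1 := hf _ (Subgroup.subset_closure ⟨i, j, h, Or.inl rfl⟩) (WithLp.toLp 2 x)
  simp only [reflection_single_sub_apply hij] at h1
  exact h1

theorem IsInvariantUnder.eval_neg_pair (hf : IsInvariantUnder (reflectionGroupD n) f)
    {i j : Fin n} (hij : i ≠ j) (x : Fin n → ℝ) :
    eval (fun k => (if k = i ∨ k = j then -1 else 1) * x k) f = eval x f := by
  wlog h : i < j generalizing i j
  · rw [← this hij.symm (lt_of_le_of_ne (not_lt.1 h) hij.symm)]
    simp only [or_comm]
  have hf' := hf
  rw [isInvariantUnder_iff] at hf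
  have h1 := hf _ (Subgroup.subset_closure ⟨i, j, h, Or.inr rfl⟩)
    (WithLp.toLp 2 fun k => x (Equiv.swap i j k))
  simp only [reflection_single_add_apply hij, Equiv.swap_apply_self] at h1
  rw [h1]
  exact hf'.eval_swap hij x

theorem IsInvariantUnder.coeff_swap (hf : IsInvariantUnder (reflectionGroupD n) f)
    {i j : Fin n} (hij : i ≠ j) (m : Fin n →₀ ℕ) :
    coeff (m.mapDomain (Equiv.swap i j)) f = coeff m f := by
  have h : rename (Equiv.swap i j) f = f := by
    refine MvPolynomial.funext fun x => ?_
    rw [eval_rename]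
    exact hf.eval_swap hij x
  conv_lhs => rw [← h]
  exact coeff_rename_mapDomain _ (Equiv.injective _) _ _

theorem coeff_aeval_C_mul_X {τ : Type*} (s : τ → ℝ) (f : MvPolynomial τ ℝ) (m : τ →₀ ℕ) :
    coeff m (aeval (fun i => C (s i) * X i) f) = (m.prod fun i k => s i ^ k) * coeff m f := by
  classical
  induction f using MvPolynomial.induction_on' with
  | add p q hp hq => rw [map_add, coeff_add, coeff_add, hp, hq, mul_add]
  | monomial u a =>
    rw [aeval_monomial]
    simp only [mul_pow, Finsupp.prod_mul, algebraMap_eq]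
    have h1 : (u.prod fun i k => (C (s i) : MvPolynomial τ ℝ) ^ k)
        = C (u.prod fun i k => s i ^ k) := by
      simp [Finsupp.prod]
    rw [h1, ← mul_assoc, ← C_mul, ← monomial_eq, coeff_monomial, coeff_monomial]
    split_ifs with h
    · rw [h, mul_comm]
    · simp

/-- Negating the coordinates `i` and `j` multiplies this coefficient by `(-1) ^ (m i + m j)`. -/
theorem IsInvariantUnder.coeff_eq_zero (hf : IsInvariantUnder (reflectionGroupD n) f)
    {i j : Fin n} (hij : i ≠ j) {m : Fin n →₀ ℕ} (hm : Odd (m i + m j)) : coeff m f = 0 := by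
  classical
  let s : Fin n → ℝ := fun k => if k = i ∨ k = j then -1 else 1
  have h : aeval (fun k => C (s k) * X k) f = f := by
    refine MvPolynomial.funext fun x => ?_
    rw [eval_aeval]
    simp only [map_mul, eval_C, eval_X]
    exact hf.eval_neg_pair hij x
  have h1 := coeff_aeval_C_mul_X s f m
  rw [h] at h1
  have h2 : (m.prod fun i k => s i ^ k) = -1 := by
    rw [Finsupp.prod_fintype _ _ (fun _ => pow_zero _)]
    rw [← Finset.mul_prod_erase _ _ (Finset.mem_univ i),
      ← Finset.mul_prod_erase _ _ (Finset.mem_erase.2 ⟨hij.symm, Finset.mem_univ j⟩),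
      Finset.prod_eq_one]
    · have h3 : s i = -1 := by simp [s]
      have h4 : s j = -1 := by simp [s]
      rw [h3, h4, mul_one, ← pow_add, hm.neg_one_pow]
    · intro k hk
      have : s k = 1 := by
        simp only [Finset.mem_erase] at hk
        simp [s, hk.1, hk.2.1]
      rw [this, one_pow]
  rw [h2] at h1
  linarith

end Invariant

/-! ### An invariant quartic that divides every polynomial vanishing on its real zeros. -/

/-- Divide `h` by `g` in the first variable. For `y` in the box the remainder has more zeros than
its degree allows, so its coefficients vanish on a product of infinite sets and are therefore zero.
-/
theorem isRealPrincipal_of_monic {m : ℕ} {g : MvPolynomial (Fin (m + 1)) ℝ}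
    (hg : (finSuccEquiv ℝ m g).Monic) (s : Fin m → Set ℝ) (hs : ∀ i, (s i).Infinite)
    (hroots : ∀ y ∈ Set.pi Set.univ s, ∃ T : Finset ℝ,
      (finSuccEquiv ℝ m g).natDegree ≤ T.card ∧
        ∀ t ∈ T, eval (Fin.cons t y : Fin (m + 1) → ℝ) g = 0) :
    IsRealPrincipal g := by
  intro h hh
  set G := finSuccEquiv ℝ m g with hG
  set H := finSuccEquiv ℝ m h with hH
  have hdvd : G ∣ H := by
    rw [← Polynomial.modByMonic_eq_zero_iff_dvd hg]
    ext1 i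
    refine funext_set s hs fun y hy => ?_
    obtain ⟨T, hT1, hT2⟩ := hroots y hy
    have hr : (H %ₘ G).map (eval y) = 0 := by
      by_cases hG1 : G = 1
      · simp [hG1]
      refine Polynomial.eq_zero_of_natDegree_lt_card_of_eval_eq_zero' _ T (fun t ht => ?_) ?_
      · have h1 := hh _ (hT2 t ht)
        have h2 := hT2 t ht
        rw [eval_eq_eval_mv_eval'] at h1 h2
        rw [← hG] at h2
        rw [← hH, ← Polynomial.modByMonic_add_div H G, Polynomial.map_add, Polynomial.map_mul,
          Polynomial.eval_add, Polynomial.eval_mul, h2, zero_mul, add_zero] at h1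
        exact h1
      · refine lt_of_le_of_lt Polynomial.natDegree_map_le ?_
        exact (Polynomial.natDegree_modByMonic_lt H hg hG1).trans_le hT1
    have := congrArg (fun p => p.coeff i) hr
    simpa [Polynomial.coeff_map] using this
  obtain ⟨k, hk⟩ := hdvd
  refine ⟨(finSuccEquiv ℝ m).symm k, ?_⟩
  apply (finSuccEquiv ℝ m).injective
  rw [map_mul, AlgEquiv.apply_symm_apply]
  exact hk

/-- An indefinite quartic in the squares of the variables. -/
noncomputable def indefiniteQuartic (n : ℕ) : MvPolynomial (Fin n) ℝ :=
  2 * psum (Fin n) ℝ 4 - psum (Fin n) ℝ 2 ^ 2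

theorem isHomogeneous_ofNat_mul {τ : Type*} {d : ℕ} {f : MvPolynomial τ ℝ} (a : ℕ) [a.AtLeastTwo]
    (hf : f.IsHomogeneous d) : (OfNat.ofNat a * f : MvPolynomial τ ℝ).IsHomogeneous d := by
  have : (OfNat.ofNat a : MvPolynomial τ ℝ) = C (OfNat.ofNat a) := (map_ofNat C a).symm
  rw [this]
  exact hf.C_mul _

theorem isHomogeneous_indefiniteQuartic (n : ℕ) : (indefiniteQuartic n).IsHomogeneous 4 :=
  (isHomogeneous_ofNat_mul 2 (isHomogeneous_psum n 4)).sub ((isHomogeneous_psum n 2).pow 2)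

theorem finSuccEquiv_indefiniteQuartic (m : ℕ) :
    finSuccEquiv ℝ m (indefiniteQuartic (m + 1)) =
      Polynomial.X ^ 4 - Polynomial.C (2 * psum (Fin m) ℝ 2) * Polynomial.X ^ 2 +
        Polynomial.C (indefiniteQuartic m) := by
  have h : ∀ k, finSuccEquiv ℝ m (psum (Fin (m + 1)) ℝ k) =
      Polynomial.X ^ k + Polynomial.C (psum (Fin m) ℝ k) := by
    intro k
    simp only [psum, Fin.sum_univ_succ, map_add, map_pow, map_sum, finSuccEquiv_X_zero,
      finSuccEquiv_X_succ]
  simp only [indefiniteQuartic, map_sub, map_mul, map_pow, h, map_ofNat]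
  ring

/-- The roots satisfy `t² = s ± √(2 (s² - q))`. The two hypotheses make the square root positive and
smaller than `s`, so there are four distinct real roots. -/
theorem exists_roots_biquadratic {s q : ℝ} (hs : 0 < s) (h1 : q < s ^ 2) (h2 : s ^ 2 < 2 * q) :
    ∃ T : Finset ℝ, T.card = 4 ∧ ∀ t ∈ T, t ^ 4 - 2 * s * t ^ 2 + (2 * q - s ^ 2) = 0 := by
  have hD : 0 < 2 * (s ^ 2 - q) := by linarith
  set e := Real.sqrt (2 * (s ^ 2 - q)) with he
  have he2 : e ^ 2 = 2 * (s ^ 2 - q) := Real.sq_sqrt hD.le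
  have he0 : 0 < e := Real.sqrt_pos.2 hD
  have hes : e < s := by
    refine lt_of_pow_lt_pow_left₀ 2 hs.le ?_
    linarith
  set u := Real.sqrt (s - e) with hu
  set v := Real.sqrt (s + e) with hv
  have hu2 : u ^ 2 = s - e := Real.sq_sqrt (by linarith)
  have hv2 : v ^ 2 = s + e := Real.sq_sqrt (by linarith)
  have hu0 : 0 < u := Real.sqrt_pos.2 (by linarith)
  have huv : u < v := Real.sqrt_lt_sqrt (by linarith) (by linarith)
  refine ⟨{u, v, -u, -v}, ?_, ?_⟩
  · rw [Finset.card_insert_of_notMem, Finset.card_insert_of_notMem,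
      Finset.card_insert_of_notMem, Finset.card_singleton]
    · simp only [Finset.mem_singleton]; intro h; linarith
    · simp only [Finset.mem_insert, Finset.mem_singleton, not_or]
      constructor <;> intro h <;> linarith
    · simp only [Finset.mem_insert, Finset.mem_singleton, not_or]
      refine ⟨?_, ?_, ?_⟩ <;> intro h <;> linarith
  · have key : ∀ t : ℝ, t ^ 2 = s - e ∨ t ^ 2 = s + e →
        t ^ 4 - 2 * s * t ^ 2 + (2 * q - s ^ 2) = 0 := by
      rintro t (h | h)
      · rw [show t ^ 4 = (t ^ 2) ^ 2 by ring, h]; linear_combination he2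
      · rw [show t ^ 4 = (t ^ 2) ^ 2 by ring, h]; linear_combination he2
    intro t ht
    simp only [Finset.mem_insert, Finset.mem_singleton] at ht
    rcases ht with rfl | rfl | rfl | rfl
    · exact key _ (Or.inl hu2)
    · exact key _ (Or.inr hv2)
    · exact key _ (Or.inl (by rw [neg_sq, hu2]))
    · exact key _ (Or.inr (by rw [neg_sq, hv2]))

theorem isRealPrincipal_indefiniteQuartic (m : ℕ) :
    IsRealPrincipal (indefiniteQuartic (m + 3)) := by
  have hE := finSuccEquiv_indefiniteQuartic (m + 2)
  have hmon : (finSuccEquiv ℝ (m + 2) (indefiniteQuartic (m + 3))).Monic := by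
    rw [hE]; monicity!
  have hdeg : (finSuccEquiv ℝ (m + 2) (indefiniteQuartic (m + 3))).natDegree = 4 := by
    rw [hE]; compute_degree!
  -- One coordinate dominates, which gives `s² < 2q`. At least one further coordinate is nonzero,
  -- which gives `q < s²`; this is where three variables are needed.
  refine isRealPrincipal_of_monic hmon
    (Fin.cons (Set.Ioi (2 * (m + 1 : ℝ))) fun _ => Set.Ioo 0 1) ?_ ?_
  · intro i
    refine Fin.cases ?_ (fun i => ?_) i
    · exact Set.Ioi_infinite _
    · exact Set.Ioo_infinite one_pos
  · intro y hy
    rw [hdeg]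
    have hy0 : 2 * (m + 1 : ℝ) < y 0 := hy 0 (Set.mem_univ _)
    have hyi : ∀ i : Fin (m + 1), y i.succ ∈ Set.Ioo (0 : ℝ) 1 := fun i =>
      hy i.succ (Set.mem_univ _)
    set r2 := ∑ i : Fin (m + 1), y i.succ ^ 2 with hr2
    set r4 := ∑ i : Fin (m + 1), y i.succ ^ 4 with hr4
    have hs : ∑ i, y i ^ 2 = y 0 ^ 2 + r2 := Fin.sum_univ_succ _
    have hq : ∑ i, y i ^ 4 = y 0 ^ 4 + r4 := Fin.sum_univ_succ _
    have hr2pos : 0 < r2 := Finset.sum_pos (fun i _ => pow_pos (hyi i).1 2) Finset.univ_nonempty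
    have hr4pos : 0 < r4 := Finset.sum_pos (fun i _ => pow_pos (hyi i).1 4) Finset.univ_nonempty
    have hr2le : r2 ≤ m + 1 := by
      have : r2 ≤ ∑ _i : Fin (m + 1), (1 : ℝ) :=
        Finset.sum_le_sum fun i _ => pow_le_one₀ (hyi i).1.le (hyi i).2.le
      simpa using this
    have hr42 : r4 ≤ r2 ^ 2 := by
      have := Finset.sum_sq_le_sq_sum_of_nonneg (s := Finset.univ)
        (f := fun i : Fin (m + 1) => y i.succ ^ 2) (fun i _ => sq_nonneg _)
      simpa [← pow_mul] using this
    have hm : (0 : ℝ) ≤ m := Nat.cast_nonneg m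
    have hy00 : 0 < y 0 := by linarith
    obtain ⟨T, hT1, hT2⟩ := exists_roots_biquadratic (s := y 0 ^ 2 + r2) (q := y 0 ^ 4 + r4)
      (by positivity) (by nlinarith [mul_pos (pow_pos hy00 2) hr2pos])
      (by
        have h1 : 4 * (r2 * r2) ≤ y 0 ^ 2 := by nlinarith
        have h2 : 4 * r2 ≤ y 0 ^ 2 := by nlinarith
        nlinarith [mul_le_mul_of_nonneg_left h2 (sq_nonneg (y 0)), pow_pos hy00 2])
    refine ⟨T, hT1.ge, fun t ht => ?_⟩
    rw [← hT2 t ht]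
    simp only [indefiniteQuartic, map_sub, map_mul, map_pow, map_ofNat, eval_psum,
      Fin.sum_univ_succ (n := m + 2), Fin.cons_zero, Fin.cons_succ, hs, hq]
    ring

/-! ### Non-negativity of a family of symmetric cubics on the orthant. -/

theorem sum_comp_update {ι : Type*} [Fintype ι] [DecidableEq ι] (w : ι → ℝ) (i : ι) (u : ℝ)
    (g : ℝ → ℝ) : ∑ l, g (Function.update w i u l) = ∑ l, g (w l) + (g u - g (w i)) := by
  rw [← Finset.add_sum_erase _ _ (Finset.mem_univ i),
    ← Finset.add_sum_erase _ (fun l => g (w l)) (Finset.mem_univ i), Function.update_self]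
  have : ∑ l ∈ Finset.univ.erase i, g (Function.update w i u l)
      = ∑ l ∈ Finset.univ.erase i, g (w l) :=
    Finset.sum_congr rfl fun l hl => by rw [Function.update_of_ne (Finset.ne_of_mem_erase hl)]
  rw [this]; ring

theorem sum_comp_update_update {ι : Type*} [Fintype ι] [DecidableEq ι] (w : ι → ℝ) {i j : ι}
    (hij : i ≠ j) (u v : ℝ) (g : ℝ → ℝ) :
    ∑ l, g (Function.update (Function.update w i u) j v l) =
      ∑ l, g (w l) + (g u - g (w i)) + (g v - g (w j)) := by
  rw [sum_comp_update, sum_comp_update, Function.update_of_ne hij.symm]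

/-- A symmetric cubic restricted to the simplex. -/
noncomputable def simplexCubic {ι : Type*} [Fintype ι] (k : ℝ) (w : ι → ℝ) : ℝ :=
  1 - (2 * k + 1) * ∑ i, w i ^ 2 + k * (k + 1) * ∑ i, w i ^ 3

section Simplex

variable {ι : Type*} [Fintype ι] [DecidableEq ι] {k : ℝ} {w : ι → ℝ}

/-- With `w i + w j` fixed, the cubic is affine in the product of the two coordinates. -/
theorem simplexCubic_update_update (w : ι → ℝ) {i j : ι} (hij : i ≠ j) {u v : ℝ}
    (h : u + v = w i + w j) :
    simplexCubic k (Function.update (Function.update w i u) j v) = simplexCubic k w +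
      (2 * (2 * k + 1) - 3 * k * (k + 1) * (w i + w j)) * (u * v - w i * w j) := by
  unfold simplexCubic
  rw [sum_comp_update_update w hij u v (fun t => t ^ 2),
    sum_comp_update_update w hij u v (fun t => t ^ 3)]
  obtain rfl : u = w i + w j - v := by linarith
  ring

theorem update_update_mem_stdSimplex (hw : w ∈ stdSimplex ℝ ι) {i j : ι} (hij : i ≠ j) {u v : ℝ}
    (hu : 0 ≤ u) (hv : 0 ≤ v) (h : u + v = w i + w j) :
    Function.update (Function.update w i u) j v ∈ stdSimplex ℝ ι := by
  refine ⟨fun l => ?_, ?_⟩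
  · by_cases hj : l = j
    · subst hj; simpa using hv
    · by_cases hi : l = i
      · subst hi; simpa [hj] using hu
      · simpa [hi, hj] using hw.1 l
  · have := sum_comp_update_update w hij u v id
    simp only [id] at this
    rw [this, hw.2]; linarith

/-- Moving the product down to 0 shows that its slope is not positive. If the coordinates differ,
the product can also grow by averaging them, so the slope is zero. -/
theorem IsMinOn.simplexCubic_pair (hw : w ∈ stdSimplex ℝ ι)
    (hmin : IsMinOn (simplexCubic k) (stdSimplex ℝ ι) w) {i j : ι} (hij : i ≠ j)
    (hi : 0 < w i) (hj : 0 < w j) :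
    2 * (2 * k + 1) - 3 * k * (k + 1) * (w i + w j) ≤ 0 ∧
      (w i ≠ w j → 2 * (2 * k + 1) - 3 * k * (k + 1) * (w i + w j) = 0) := by
  have key : ∀ u v : ℝ, 0 ≤ u → 0 ≤ v → u + v = w i + w j →
      0 ≤ (2 * (2 * k + 1) - 3 * k * (k + 1) * (w i + w j)) * (u * v - w i * w j) := by
    intro u v hu hv h
    have h1 := hmin (update_update_mem_stdSimplex hw hij hu hv h)
    simp only [Set.mem_ofPred_eq] at h1
    rw [simplexCubic_update_update w hij h] at h1
    linarith
  set c := 2 * (2 * k + 1) - 3 * k * (k + 1) * (w i + w j) with hc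
  have h1 := key (w i + w j) 0 (by linarith) le_rfl (by ring)
  have h2 := key ((w i + w j) / 2) ((w i + w j) / 2) (by linarith) (by linarith) (by ring)
  have hc0 : c ≤ 0 := by
    by_contra h
    push Not at h
    nlinarith [mul_pos h (mul_pos hi hj)]
  refine ⟨hc0, fun hne => le_antisymm hc0 ?_⟩
  have h3 : 0 < (w i - w j) ^ 2 := by
    have := sub_ne_zero.2 hne
    positivity
  by_contra h
  push Not at h
  nlinarith [mul_pos (neg_pos.2 h) h3]

/-- With `m` positive coordinates, all equal to `1 / m`, the value is `(m - k) (m - k - 1) / m²`,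
and no integer lies strictly between `k` and `k + 1`. -/
theorem simplexCubic_nonneg_of_forall_eq {κ : Type*} [Fintype κ] {k : ℕ} {w : κ → ℝ}
    (hw : w ∈ stdSimplex ℝ κ) {i : κ}
    (h : ∀ l, 0 < w l → w l = w i) : 0 ≤ simplexCubic (k : ℝ) w := by
  set v := w i with hv
  set m := (Finset.univ.filter fun l => 0 < w l).card with hm
  have hsum : ∀ g : ℝ → ℝ, g 0 = 0 → ∑ l, g (w l) = m * g v := by
    intro g hg
    have : ∀ l, g (w l) = if 0 < w l then g v else 0 := by
      intro l
      by_cases hp : 0 < w l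
      · rw [if_pos hp, h l hp]
      · rw [if_neg hp, le_antisymm (not_lt.1 hp) (hw.1 l), hg]
    simp only [this]
    rw [← Finset.sum_filter, Finset.sum_const, nsmul_eq_mul]
  have h1 : (m : ℝ) * v = 1 := by
    have := hsum id rfl
    simp only [id] at this
    rw [← this, hw.2]
  have h2 := hsum (fun t => t ^ 2) (by norm_num)
  have h3 := hsum (fun t => t ^ 3) (by norm_num)
  have hint : (0 : ℝ) ≤ ((m : ℝ) - k) * ((m : ℝ) - k - 1) := by
    have : (0 : ℤ) ≤ ((m : ℤ) - k) * ((m : ℤ) - k - 1) := by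
      rcases le_or_gt ((m : ℤ) - k) 0 with h | h
      · exact mul_nonneg_of_nonpos_of_nonpos h (by omega)
      · exact mul_nonneg h.le (by omega)
    exact_mod_cast this
  have : simplexCubic (k : ℝ) w = v ^ 2 * (((m : ℝ) - k) * ((m : ℝ) - k - 1)) := by
    unfold simplexCubic
    rw [h2, h3]
    linear_combination (k * (k + 1) * v ^ 2 - (m * v + 1)) * h1
  rw [this]
  positivity

/-- If a minimiser has two different positive coordinates, the slope for this pair is zero, so
merging them into one coordinate gives another minimiser. A positive coordinate different from the
merged one would again force slope zero, now for a strictly larger coordinate sum, which is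
impossible. So all positive coordinates of the new minimiser are equal. -/
theorem simplexCubic_nonneg (k : ℕ) (hw : w ∈ stdSimplex ℝ ι) : 0 ≤ simplexCubic (k : ℝ) w := by
  obtain ⟨z, hz, hmin⟩ := (isCompact_stdSimplex ℝ ι).exists_isMinOn ⟨w, hw⟩
    (f := simplexCubic (k : ℝ)) (by unfold simplexCubic; fun_prop)
  refine le_trans ?_ (hmin hw)
  have hex : ∃ i, 0 < z i := by
    by_contra h
    push Not at h
    have := Finset.sum_nonpos fun i (_ : i ∈ Finset.univ) => h i
    rw [hz.2] at this
    linarith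
  obtain ⟨i, hi⟩ := hex
  by_cases hall : ∀ l, 0 < z l → z l = z i
  · exact simplexCubic_nonneg_of_forall_eq hz hall
  push Not at hall
  obtain ⟨j, hj, hji⟩ := hall
  have hij : i ≠ j := fun h => hji (by rw [h])
  have hc := (IsMinOn.simplexCubic_pair hz hmin hij hi hj).2 hji.symm
  have hk : (0 : ℝ) < k := by
    rcases Nat.eq_zero_or_pos k with h | h
    · subst h; norm_num at hc
    · exact_mod_cast h
  set z' := Function.update (Function.update z i (z i + z j)) j 0 with hz'def
  have hz' : z' ∈ stdSimplex ℝ ι :=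
    update_update_mem_stdSimplex hz hij (by linarith) le_rfl (by ring)
  have hval : simplexCubic (k : ℝ) z' = simplexCubic (k : ℝ) z := by
    rw [hz'def, simplexCubic_update_update z hij (by ring), hc]; ring
  have hmin' : IsMinOn (simplexCubic (k : ℝ)) (stdSimplex ℝ ι) z' := by
    intro y hy
    simp only [Set.mem_ofPred_eq]
    rw [hval]; exact hmin hy
  have hzi : z' i = z i + z j := by simp [hz'def, hij]
  rw [← hval]
  refine simplexCubic_nonneg_of_forall_eq hz' (i := i) fun l hl => ?_
  by_cases hli : l = i
  · rw [hli]
  have hlj : l ≠ j := by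
    rintro rfl
    simp [hz'def] at hl
  have hzl : z' l = z l := by simp [hz'def, hli, hlj]
  rw [hzl] at hl
  by_contra hne
  have hc' := (IsMinOn.simplexCubic_pair hz' hmin' hli (by rw [hzl]; exact hl)
    (by rw [hzi]; linarith)).2 hne
  rw [hzl, hzi] at hc'
  have : (0 : ℝ) < 3 * k * (k + 1) * z l := by positivity
  linarith

end Simplex

theorem symmetricCubic_nonneg (k : ℕ) {ι : Type*} [Fintype ι] {a : ι → ℝ} (ha : ∀ i, 0 ≤ a i) :
    0 ≤ (∑ i, a i) ^ 3 - (2 * k + 1) * (∑ i, a i) * ∑ i, a i ^ 2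
      + k * (k + 1) * ∑ i, a i ^ 3 := by
  classical
  set S := ∑ i, a i with hS
  have hS0 : 0 ≤ S := Finset.sum_nonneg fun i _ => ha i
  rcases hS0.eq_or_lt with h | h
  · have hz : ∀ i, a i = 0 := fun i =>
      (Finset.sum_eq_zero_iff_of_nonneg fun i _ => ha i).1 h.symm i (Finset.mem_univ i)
    simp [← h, hz]
  · have hw : (fun i => a i / S) ∈ stdSimplex ℝ ι := by
      refine ⟨fun i => div_nonneg (ha i) hS0, ?_⟩
      rw [← Finset.sum_div, ← hS, div_self h.ne']
    have h1 := simplexCubic_nonneg k hw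
    unfold simplexCubic at h1
    simp only [div_pow, ← Finset.sum_div] at h1
    have h2 := mul_nonneg h1 (pow_nonneg hS0 3)
    have h3 : (1 - (2 * (k : ℝ) + 1) * ((∑ i, a i ^ 2) / S ^ 2)
        + k * (k + 1) * ((∑ i, a i ^ 3) / S ^ 3)) * S ^ 3 =
        S ^ 3 - (2 * k + 1) * S * ∑ i, a i ^ 2 + k * (k + 1) * ∑ i, a i ^ 3 := by
      field_simp
    rwa [h3] at h2

/-! ### Linear relations between the values of forms at finitely many points. -/

theorem MvPolynomial.IsHomogeneous.sum_eq_of_mem_support {τ : Type*} [Fintype τ] {d : ℕ}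
    {h : MvPolynomial τ ℝ} (hh : h.IsHomogeneous d) {m : τ →₀ ℕ} (hm : m ∈ h.support) :
    ∑ i, m i = d := by
  rw [hh.degree_eq_sum_deg_support hm]
  exact (Finset.sum_subset (Finset.subset_univ _) (by simp)).symm

theorem MvPolynomial.IsHomogeneous.eval_mul {τ : Type*} [Fintype τ] {d : ℕ} {h : MvPolynomial τ ℝ}
    (hh : h.IsHomogeneous d) (t : ℝ) (x : τ → ℝ) :
    eval (fun i => t * x i) h = t ^ d * eval x h := by
  rw [eval_eq', eval_eq', Finset.mul_sum]
  refine Finset.sum_congr rfl fun m hm => ?_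
  have h1 : ∑ i, m i = d := hh.sum_eq_of_mem_support hm
  simp only [mul_pow, Finset.prod_mul_distrib, Finset.prod_pow_eq_pow_sum, h1]
  ring

theorem MvPolynomial.IsHomogeneous.sum_mul_eval_eq_zero {τ α : Type*} [Fintype τ] {d : ℕ}
    {h : MvPolynomial τ ℝ} (hh : h.IsHomogeneous d) (s : Finset α) (c : α → ℝ) (P : α → τ → ℝ)
    (H : ∀ m : τ → ℕ, ∑ i, m i = d → ∑ a ∈ s, c a * ∏ i, P a i ^ m i = 0) :
    ∑ a ∈ s, c a * eval (P a) h = 0 := by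
  simp only [eval_eq', Finset.mul_sum]
  rw [Finset.sum_comm]
  refine Finset.sum_eq_zero fun m hm => ?_
  have h1 : ∑ i, m i = d := hh.sum_eq_of_mem_support hm
  have h2 := H m h1
  calc _ = coeff m h * ∑ a ∈ s, c a * ∏ i, P a i ^ m i := by
        rw [Finset.mul_sum]; exact Finset.sum_congr rfl fun a _ => by ring
    _ = 0 := by rw [h2, mul_zero]

/-- A form of small degree cannot vanish at all points `(1, y)`, `y ∈ {0, 1, -1}^r`, except at
the centre `y = 0`. -/
theorem eval_cons_one_zero_eq_zero {r d : ℕ} (hd : d < 2 * r)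
    {h : MvPolynomial (Fin (r + 1)) ℝ} (hh : h.IsHomogeneous d)
    (hz : ∀ y : Fin r → ℝ, (∀ i, y i = 0 ∨ y i = 1 ∨ y i = -1) → y ≠ 0 →
      eval (Fin.cons 1 y : Fin (r + 1) → ℝ) h = 0) :
    eval (Fin.cons 1 0 : Fin (r + 1) → ℝ) h = 0 := by
  classical
  set T : Finset (Fin r → ℝ) := Fintype.piFinset fun _ => {0, 1, -1} with hT
  -- These are minus the second difference weights. They annihilate `t ^ k` for `k = 0` and for odd
  -- `k`, so a surviving monomial has degree at least 2 in each of the `r` variables.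
  set wt : ℝ → ℝ := fun t => if t = 0 then 2 else -1 with hwt
  have key := hh.sum_mul_eval_eq_zero T (fun y => ∏ i, wt (y i))
    (fun y => (Fin.cons 1 y : Fin (r + 1) → ℝ)) (by
      intro m hm
      simp only [Fin.prod_univ_succ, Fin.cons_zero, Fin.cons_succ, one_pow, one_mul,
        ← Finset.prod_mul_distrib]
      refine (Finset.prod_univ_sum (t := fun _ : Fin r => ({0, 1, -1} : Finset ℝ))
        (f := fun i t => wt t * t ^ m i.succ)).symm.trans ?_
      have hex : ∃ i : Fin r, m i.succ = 0 ∨ Odd (m i.succ) := by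
        by_contra hcon
        push Not at hcon
        have h2 : ∀ i : Fin r, 2 ≤ m i.succ := by
          intro i
          obtain ⟨h0, h1⟩ := hcon i
          rw [Nat.not_odd_iff_even] at h1
          obtain ⟨j, hj⟩ := h1
          omega
        have h3 : ∑ i : Fin r, 2 ≤ ∑ i : Fin r, m i.succ := Finset.sum_le_sum fun i _ => h2 i
        rw [Fin.sum_univ_succ] at hm
        simp at h3
        omega
      obtain ⟨i, hi⟩ := hex
      refine Finset.prod_eq_zero (Finset.mem_univ i) ?_
      have h4 : ({0, 1, -1} : Finset ℝ).sum (fun t => wt t * t ^ m i.succ) =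
          2 * 0 ^ m i.succ - 1 - (-1) ^ m i.succ := by
        rw [Finset.sum_insert (by norm_num), Finset.sum_insert (by norm_num),
          Finset.sum_singleton]
        simp only [hwt]
        norm_num
        ring
      rw [h4]
      rcases hi with hi | hi
      · rw [hi]; norm_num
      · rw [hi.neg_one_pow, zero_pow hi.pos.ne']; norm_num)
  rw [Finset.sum_eq_single (0 : Fin r → ℝ)] at key
  · have : (∏ i : Fin r, wt ((0 : Fin r → ℝ) i)) ≠ 0 := by
      simp [hwt]
    exact (mul_eq_zero.1 key).resolve_left this
  · intro y hy hy0
    rw [hz y (fun i => ?_) hy0, mul_zero]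
    have := Fintype.mem_piFinset.1 hy i
    simpa using this
  · intro h0
    exact absurd (Fintype.mem_piFinset.2 fun i => by simp) h0

/-- Averaging over sign changes reduces linear relations between values of forms to monomials
of prescribed parity. -/
theorem MvPolynomial.IsHomogeneous.sum_signs_eval_eq_zero {N d : ℕ} {α : Type*}
    {h : MvPolynomial (Fin N) ℝ} (hh : h.IsHomogeneous d) (e : Fin N → ℕ)
    (s : Finset α) (c : α → ℝ) (P : α → Fin N → ℝ)
    (H : ∀ m : Fin N → ℕ, ∑ i, m i = d → (∀ i, Even (m i + e i)) →
      ∑ a ∈ s, c a * ∏ i, P a i ^ m i = 0) :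
    ∑ a ∈ s, c a * ∑ ε ∈ Fintype.piFinset (fun _ : Fin N => ({1, -1} : Finset ℝ)),
      (∏ i, ε i ^ e i) * eval (fun i => ε i * P a i) h = 0 := by
  classical
  simp only [Finset.mul_sum]
  rw [← Finset.sum_product']
  simp only [← mul_assoc]
  refine hh.sum_mul_eval_eq_zero _ (fun p : α × (Fin N → ℝ) => c p.1 * ∏ i, p.2 i ^ e i)
    (fun p i => p.2 i * P p.1 i) fun m hm => ?_
  rw [Finset.sum_product]
  have h1 : ∀ a, ∑ ε ∈ Fintype.piFinset (fun _ : Fin N => ({1, -1} : Finset ℝ)),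
      (c a * ∏ i, ε i ^ e i) * ∏ i, (ε i * P a i) ^ m i =
      (c a * ∏ i, P a i ^ m i) * ∏ i, (1 + (-1 : ℝ) ^ (m i + e i)) := by
    intro a
    have h2 : ∏ i, (1 + (-1 : ℝ) ^ (m i + e i)) =
        ∏ i : Fin N, ∑ t ∈ ({1, -1} : Finset ℝ), t ^ (m i + e i) := by
      refine Finset.prod_congr rfl fun i _ => ?_
      rw [Finset.sum_insert (by norm_num), Finset.sum_singleton, one_pow]
    rw [h2, Finset.prod_univ_sum, Finset.mul_sum]
    refine Finset.sum_congr rfl fun ε _ => ?_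
    simp only [mul_pow, pow_add, Finset.prod_mul_distrib]
    ring
  simp only [h1]
  rw [← Finset.sum_mul]
  by_cases hev : ∀ i, Even (m i + e i)
  · rw [H m hm hev, zero_mul]
  · push Not at hev
    obtain ⟨i, hi⟩ := hev
    rw [Nat.not_even_iff_odd] at hi
    rw [Finset.prod_eq_zero (Finset.mem_univ i), mul_zero]
    rw [hi.neg_one_pow]; norm_num

/-- A summand that is nonzero at `x` still vanishes at every zero of `f`, because the squares cannot
cancel. -/
theorem IsSOSOfDegree.exists_form_ne_zero {τ : Type*} {d : ℕ} {f : MvPolynomial τ ℝ}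
    (hf : IsSOSOfDegree d f) {x : τ → ℝ} (hx : eval x f ≠ 0) :
    ∃ h : MvPolynomial τ ℝ, h.IsHomogeneous d ∧ eval x h ≠ 0 ∧
      ∀ y, eval y f = 0 → eval y h = 0 := by
  obtain ⟨ι, _, q, hq, rfl⟩ := hf
  have : ∃ k, eval x (q k) ≠ 0 := by
    by_contra hcon
    push Not at hcon
    apply hx
    simp [hcon]
  obtain ⟨k, hk⟩ := this
  refine ⟨q k, hq k, hk, fun y hy => ?_⟩
  rw [map_sum] at hy
  simp only [map_pow] at hy
  rw [Finset.sum_eq_zero_iff_of_nonneg (fun i _ => sq_nonneg _)] at hy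
  exact pow_eq_zero_iff (two_ne_zero) |>.1 (hy k (Finset.mem_univ _))

theorem IsSOSOfDegree.aeval {σ τ : Type*} {d : ℕ} {f : MvPolynomial σ ℝ}
    (hf : IsSOSOfDegree d f) (g : σ → MvPolynomial τ ℝ) (hg : ∀ i, (g i).IsHomogeneous 1) :
    IsSOSOfDegree d (MvPolynomial.aeval g f) := by
  obtain ⟨ι, _, q, hq, rfl⟩ := hf
  refine ⟨ι, inferInstance, fun k => MvPolynomial.aeval g (q k), fun k => ?_, ?_⟩
  · simpa using (hq k).aeval g (n := 1) hg
  · simp only [map_sum, map_pow]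

/-! ### Non-negative invariant forms that are not sums of squares. -/

/-- The even symmetric sextic `∑ a_i (S - k a_i) (S - (k + 1) a_i)` in the squares `a_i` of the
variables, where `S = ∑ a_i`. -/
noncomputable def evenSextic (n k : ℕ) : MvPolynomial (Fin n) ℝ :=
  psum (Fin n) ℝ 2 ^ 3 - C (2 * k + 1 : ℝ) * (psum (Fin n) ℝ 2 * psum (Fin n) ℝ 4)
    + C (k * (k + 1) : ℝ) * psum (Fin n) ℝ 6

/-- The even symmetric ternary decic `∑ a (a - b) (a - c) (a - b - c)²` in the squares `a`, `b`,
`c` of the variables. -/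
noncomputable def ternaryDecic : MvPolynomial (Fin 3) ℝ :=
  C 8 * psum (Fin 3) ℝ 10 - C 12 * (psum (Fin 3) ℝ 2 * psum (Fin 3) ℝ 8)
    + C 6 * (psum (Fin 3) ℝ 2 ^ 2 * psum (Fin 3) ℝ 6) - psum (Fin 3) ℝ 2 ^ 3 * psum (Fin 3) ℝ 4
    + C (1 / 6) * (evenSextic 3 1 * (C 4 * psum (Fin 3) ℝ 4 - psum (Fin 3) ℝ 2 ^ 2))

theorem isHomogeneous_evenSextic (n k : ℕ) : (evenSextic n k).IsHomogeneous 6 := by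
  have h2 := isHomogeneous_psum n 2
  have h4 := isHomogeneous_psum n 4
  exact ((h2.pow 3).sub ((h2.mul h4).C_mul _)).add ((isHomogeneous_psum n 6).C_mul _)

theorem isHomogeneous_ternaryDecic : ternaryDecic.IsHomogeneous 10 := by
  have h2 := isHomogeneous_psum 3 2
  have h4 := isHomogeneous_psum 3 4
  exact (((((isHomogeneous_psum 3 10).C_mul _).sub ((h2.mul (isHomogeneous_psum 3 8)).C_mul _)).add
    (((h2.pow 2).mul (isHomogeneous_psum 3 6)).C_mul _)).sub ((h2.pow 3).mul h4)).add
    (((isHomogeneous_evenSextic 3 1).mul ((h4.C_mul _).sub (h2.pow 2))).C_mul _)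

namespace IsInvariantUnder

variable {n : ℕ} {G : Subgroup (EuclideanSpace ℝ (Fin n) ≃ₗᵢ[ℝ] EuclideanSpace ℝ (Fin n))}
  {f g : MvPolynomial (Fin n) ℝ}

theorem C (c : ℝ) : IsInvariantUnder G (MvPolynomial.C c) := fun σ _ =>
  (polyAction σ).commutes c

theorem add (hf : IsInvariantUnder G f) (hg : IsInvariantUnder G g) : IsInvariantUnder G (f + g) :=
  fun σ hσ => by rw [map_add, hf σ hσ, hg σ hσ]

theorem sub (hf : IsInvariantUnder G f) (hg : IsInvariantUnder G g) : IsInvariantUnder G (f - g) :=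
  fun σ hσ => by rw [map_sub, hf σ hσ, hg σ hσ]

theorem mul (hf : IsInvariantUnder G f) (hg : IsInvariantUnder G g) : IsInvariantUnder G (f * g) :=
  fun σ hσ => by rw [map_mul, hf σ hσ, hg σ hσ]

theorem pow (hf : IsInvariantUnder G f) (k : ℕ) : IsInvariantUnder G (f ^ k) :=
  fun σ hσ => by rw [map_pow, hf σ hσ]

theorem evenSextic (n k : ℕ) : IsInvariantUnder (reflectionGroupD n) (evenSextic n k) :=
  (((psum_two_mul n 1).pow 3).sub ((C _).mul ((psum_two_mul n 1).mul (psum_two_mul n 2)))).add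
    ((C _).mul (psum_two_mul n 3))

theorem ternaryDecic : IsInvariantUnder (reflectionGroupD 3) ternaryDecic :=
  (((((C _).mul (psum_two_mul 3 5)).sub ((C _).mul ((psum_two_mul 3 1).mul
    (psum_two_mul 3 4)))).add ((C _).mul (((psum_two_mul 3 1).pow 2).mul
    (psum_two_mul 3 3)))).sub (((psum_two_mul 3 1).pow 3).mul (psum_two_mul 3 2))).add
    ((C _).mul ((evenSextic 3 1).mul (((C _).mul (psum_two_mul 3 2)).sub
      ((psum_two_mul 3 1).pow 2))))

theorem indefiniteQuartic (n : ℕ) :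
    IsInvariantUnder (reflectionGroupD n) (indefiniteQuartic n) := by
  have : (2 : MvPolynomial (Fin n) ℝ) = MvPolynomial.C 2 := (map_ofNat _ 2).symm
  unfold _root_.indefiniteQuartic
  rw [this]
  exact ((C _).mul (psum_two_mul n 2)).sub ((psum_two_mul n 1).pow 2)

end IsInvariantUnder

theorem isNonnegative_evenSextic (n k : ℕ) : IsNonnegative (evenSextic n k) := by
  intro x
  have h := symmetricCubic_nonneg k (a := fun i => x i ^ 2) fun i => sq_nonneg _
  simp only [← pow_mul] at h
  simp only [evenSextic, map_add, map_sub, map_mul, map_pow, eval_C, eval_psum]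
  linarith

theorem ternaryQuintic_nonneg_of_le {a b c : ℝ} (hc : 0 ≤ c) (hbc : c ≤ b) (hab : b ≤ a) :
    0 ≤ a * (a - b) * (a - c) * (a - b - c) ^ 2 + b * (b - a) * (b - c) * (b - a - c) ^ 2
      + c * (c - a) * (c - b) * (c - a - b) ^ 2 := by
  obtain ⟨u, rfl⟩ : ∃ u, b = c + u := ⟨b - c, by ring⟩
  obtain ⟨v, rfl⟩ : ∃ v, a = c + u + v := ⟨a - (c + u), by ring⟩
  have hu : 0 ≤ u := by linarith
  have hv : 0 ≤ v := by linarith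
  -- The quintic rewritten in the gaps `u = b - c` and `v = a - b`, with only non-negative terms.
  have h : 0 ≤ v ^ 2 * (v - c) ^ 2 * (c + 2 * u + v) + c * u * (v * (v - c) ^ 2
      + u * (c + v + 2 * u) ^ 2 + 4 * u * v * c + 4 * v * u ^ 2) := by positivity
  refine h.trans (le_of_eq ?_)
  ring

theorem ternaryQuintic_nonneg {a b c : ℝ} (ha : 0 ≤ a) (hb : 0 ≤ b) (hc : 0 ≤ c) :
    0 ≤ a * (a - b) * (a - c) * (a - b - c) ^ 2 + b * (b - a) * (b - c) * (b - a - c) ^ 2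
      + c * (c - a) * (c - b) * (c - a - b) ^ 2 := by
  rcases le_total a b with h1 | h1 <;> rcases le_total b c with h2 | h2 <;>
    rcases le_total a c with h3 | h3
  · exact (ternaryQuintic_nonneg_of_le ha h1 h2).trans (le_of_eq (by ring))
  · exact (ternaryQuintic_nonneg_of_le ha h1 h2).trans (le_of_eq (by ring))
  · exact (ternaryQuintic_nonneg_of_le ha h3 h2).trans (le_of_eq (by ring))
  · exact (ternaryQuintic_nonneg_of_le hc h3 h1).trans (le_of_eq (by ring))
  · exact (ternaryQuintic_nonneg_of_le hb h1 h3).trans (le_of_eq (by ring))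
  · exact (ternaryQuintic_nonneg_of_le hb h2 h3).trans (le_of_eq (by ring))
  · exact (ternaryQuintic_nonneg_of_le hc h2 h1).trans (le_of_eq (by ring))
  · exact (ternaryQuintic_nonneg_of_le hc h2 h1).trans (le_of_eq (by ring))

theorem eval_ternaryDecic (x : Fin 3 → ℝ) : eval x ternaryDecic =
    x 0 ^ 2 * (x 0 ^ 2 - x 1 ^ 2) * (x 0 ^ 2 - x 2 ^ 2) * (x 0 ^ 2 - x 1 ^ 2 - x 2 ^ 2) ^ 2
    + x 1 ^ 2 * (x 1 ^ 2 - x 0 ^ 2) * (x 1 ^ 2 - x 2 ^ 2) * (x 1 ^ 2 - x 0 ^ 2 - x 2 ^ 2) ^ 2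
    + x 2 ^ 2 * (x 2 ^ 2 - x 0 ^ 2) * (x 2 ^ 2 - x 1 ^ 2) * (x 2 ^ 2 - x 0 ^ 2 - x 1 ^ 2) ^ 2 := by
  simp only [ternaryDecic, evenSextic, map_add, map_sub, map_mul, map_pow, eval_C, eval_psum,
    Fin.sum_univ_three]
  push_cast
  ring

theorem isNonnegative_ternaryDecic : IsNonnegative ternaryDecic := by
  intro x
  rw [eval_ternaryDecic]
  exact ternaryQuintic_nonneg (sq_nonneg _) (sq_nonneg _) (sq_nonneg _)

/-- Setting all but the first `k` variables to zero. -/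
noncomputable def restrictVars (k m : ℕ) :
    MvPolynomial (Fin (k + m)) ℝ →ₐ[ℝ] MvPolynomial (Fin k) ℝ :=
  aeval (Fin.addCases X fun _ => 0)

theorem restrictVars_psum (k m : ℕ) {r : ℕ} (hr : r ≠ 0) :
    restrictVars k m (psum (Fin (k + m)) ℝ r) = psum (Fin k) ℝ r := by
  simp [restrictVars, psum, Fin.sum_univ_add, zero_pow hr]

theorem IsSOSOfDegree.restrictVars {k m d : ℕ} {f : MvPolynomial (Fin (k + m)) ℝ}
    (hf : IsSOSOfDegree d f) : IsSOSOfDegree d (restrictVars k m f) := by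
  refine hf.aeval _ fun i => ?_
  refine Fin.addCases (fun i => ?_) (fun i => ?_) i
  · simpa using isHomogeneous_X _ i
  · simpa using isHomogeneous_zero _ _ _

theorem restrictVars_evenSextic (k m j : ℕ) :
    restrictVars k m (evenSextic (k + m) j) = evenSextic k j := by
  simp only [evenSextic, map_add, map_sub, map_mul, map_pow, algHom_C, algebraMap_eq,
    restrictVars_psum k m (two_ne_zero), restrictVars_psum k m (four_ne_zero),
    restrictVars_psum k m (show 6 ≠ 0 by norm_num)]

/-- The form vanishes at the `0, ±1` points with two or three nonzero coordinates, but equals 2 at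
`(1, 0, 0)`. -/
theorem not_isSOSOfDegree_evenSextic_three : ¬ IsSOSOfDegree 3 (evenSextic 3 2) := by
  intro hf
  have hev : ∀ y : Fin 2 → ℝ, eval (Fin.cons 1 y : Fin 3 → ℝ) (evenSextic 3 2) =
      (1 + (y 0 ^ 2 + y 1 ^ 2)) ^ 3 - 5 * ((1 + (y 0 ^ 2 + y 1 ^ 2)) * (1 + (y 0 ^ 4 + y 1 ^ 4)))
        + 6 * (1 + (y 0 ^ 6 + y 1 ^ 6)) := by
    intro y
    simp only [evenSextic, map_add, map_sub, map_mul, map_pow, eval_C, eval_psum,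
      Fin.sum_univ_succ (n := 2), Fin.cons_zero, Fin.cons_succ, Fin.sum_univ_two]
    push_cast
    ring
  obtain ⟨h, hh, h1, h2⟩ := hf.exists_form_ne_zero (x := Fin.cons 1 0) (by
    rw [hev]; norm_num)
  refine h1 (eval_cons_one_zero_eq_zero (r := 2) (by norm_num) hh fun y hy hy0 => h2 _ ?_)
  rw [hev]
  rcases hy 0 with e0 | e0 | e0 <;> rcases hy 1 with e1 | e1 | e1 <;> rw [e0, e1]
  · exact absurd (_root_.funext fun i => by fin_cases i <;> simp [e0, e1]) hy0
  all_goals norm_num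

theorem not_isSOSOfDegree_evenSextic {n : ℕ} (hn : 3 ≤ n) : ¬ IsSOSOfDegree 3 (evenSextic n 2) := by
  obtain ⟨m, rfl⟩ := Nat.exists_eq_add_of_le hn
  intro hf
  have := hf.restrictVars
  rw [restrictVars_evenSextic] at this
  exact not_isSOSOfDegree_evenSextic_three this

theorem IsSOSOfDegree.of_sq_mul_mul {τ : Type*} {d : ℕ} {f : MvPolynomial τ ℝ} (i j k : τ)
    (h : IsSOSOfDegree (3 + d) ((X i * X j * X k) ^ 2 * f)) : IsSOSOfDegree d f := by
  have hX : ∀ i : τ, (X i : MvPolynomial τ ℝ).IsHomogeneous 1 := isHomogeneous_X _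
  refine of_sq_mul (isRealPrincipal_X k) (hX k) (X_ne_zero k) ?_
  refine of_sq_mul (isRealPrincipal_X j) (hX j) (X_ne_zero j) ?_
  refine of_sq_mul (isRealPrincipal_X i) (hX i) (X_ne_zero i) ?_
  convert h using 1
  · ring
  · ring

/-- So `evenSextic n 1` is a non-negative invariant form in any number of variables whose
restriction to three variables is a cancellable square, up to a positive constant. -/
theorem evenSextic_three_one : evenSextic 3 1 = C 6 * (X 0 * X 1 * X 2) ^ 2 := by
  refine MvPolynomial.funext fun x => ?_
  simp only [evenSextic, map_add, map_sub, map_mul, map_pow, eval_C, eval_psum,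
    Fin.sum_univ_three, eval_X]
  push_cast
  ring

theorem IsSOSOfDegree.of_evenSextic_three_mul {d : ℕ} {f : MvPolynomial (Fin 3) ℝ}
    (h : IsSOSOfDegree (3 + d) (evenSextic 3 1 * f)) : IsSOSOfDegree d f := by
  have h1 := h.C_mul (c := 1 / 6) (by norm_num)
  refine IsSOSOfDegree.of_sq_mul_mul 0 1 2 ?_
  convert h1 using 1
  rw [evenSextic_three_one, ← mul_assoc, ← mul_assoc, ← MvPolynomial.C_mul]
  norm_num

theorem not_isSOSOfDegree_evenSextic_mul {n : ℕ} (hn : 3 ≤ n) :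
    ¬ IsSOSOfDegree 6 (evenSextic n 1 * evenSextic n 2) := by
  obtain ⟨m, rfl⟩ := Nat.exists_eq_add_of_le hn
  intro hf
  have := hf.restrictVars
  rw [map_mul, restrictVars_evenSextic, restrictVars_evenSextic] at this
  exact not_isSOSOfDegree_evenSextic_three (IsSOSOfDegree.of_evenSextic_three_mul (d := 3) this)

/-- A form with prescribed zeros at sign changes of given points vanishes at the first coordinate
vector as soon as a linear relation holds for all monomials of the right parity. -/
theorem eval_single_eq_zero {N d : ℕ} {α : Type*} {h : MvPolynomial (Fin (N + 1)) ℝ}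
    (hh : h.IsHomogeneous d) (s : Finset α) (c : α → ℝ) (P : α → Fin (N + 1) → ℝ)
    {a₀ : α} (ha₀ : a₀ ∈ s) (hc : c a₀ ≠ 0) (hP : P a₀ = Pi.single 0 1)
    (H : ∀ m : Fin (N + 1) → ℕ, ∑ i, m i = d → Even (m 0 + d) → (∀ i : Fin N, Even (m i.succ)) →
      ∑ a ∈ s, c a * ∏ i, P a i ^ m i = 0)
    (hz : ∀ a ∈ s, a ≠ a₀ → ∀ ε : Fin (N + 1) → ℝ, (∀ i, ε i ^ 2 = 1) →
      eval (fun i => ε i * P a i) h = 0) :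
    eval (Pi.single 0 1) h = 0 := by
  classical
  have hsq : ∀ ε ∈ Fintype.piFinset (fun _ : Fin (N + 1) => ({1, -1} : Finset ℝ)),
      ∀ i, ε i ^ 2 = 1 := by
    intro ε hε i
    have := Fintype.mem_piFinset.1 hε i
    simp only [Finset.mem_insert, Finset.mem_singleton] at this
    rcases this with e | e <;> rw [e] <;> norm_num
  -- The character `ε 0 ^ d` compensates the sign of `h` at `± e₀`, so that the value at `e₀`
  -- survives the averaging over signs.
  have key := hh.sum_signs_eval_eq_zero (Fin.cons d fun _ => 0) s c P (by
    intro m hm he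
    exact H m hm (by simpa using he 0) fun i => by simpa using he i.succ)
  rw [Finset.sum_eq_single a₀] at key
  · have h1 : ∀ ε ∈ Fintype.piFinset (fun _ : Fin (N + 1) => ({1, -1} : Finset ℝ)),
        (∏ i, ε i ^ (Fin.cons d fun _ => 0 : Fin (N + 1) → ℕ) i) *
          eval (fun i => ε i * P a₀ i) h = eval (Pi.single 0 1) h := by
      intro ε hε
      have h2 : (fun i => ε i * P a₀ i) = fun i => ε 0 * (Pi.single 0 1 : Fin (N + 1) → ℝ) i := by
        funext i
        rw [hP]
        by_cases hi : i = 0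
        · rw [hi]
        · simp [hi]
      rw [h2, hh.eval_mul, Fin.prod_univ_succ]
      simp only [Fin.cons_zero, Fin.cons_succ, pow_zero, Finset.prod_const_one, mul_one]
      rw [← mul_assoc, ← pow_add, ← two_mul, pow_mul, hsq ε hε 0, one_pow, one_mul]
    rw [Finset.sum_congr rfl h1, Finset.sum_const, nsmul_eq_mul] at key
    have h3 : ((Fintype.piFinset fun _ : Fin (N + 1) => ({1, -1} : Finset ℝ)).card : ℝ) ≠ 0 := by
      rw [Nat.cast_ne_zero, ← Nat.pos_iff_ne_zero, Finset.card_pos]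
      exact ⟨fun _ => 1, Fintype.mem_piFinset.2 fun i => by simp⟩
    exact (mul_eq_zero.1 ((mul_eq_zero.1 key).resolve_left hc)).resolve_left h3
  · intro a ha hne
    rw [Finset.sum_eq_zero, mul_zero]
    intro ε hε
    rw [hz a ha hne ε (hsq ε hε), mul_zero]
  · intro hn
    exact absurd ha₀ hn

theorem not_isSOSOfDegree_ternaryDecic : ¬ IsSOSOfDegree 5 ternaryDecic := by
  intro hf
  obtain ⟨h, hh, h1, h2⟩ := hf.exists_form_ne_zero (x := Pi.single 0 1) (by
    rw [eval_ternaryDecic]; simp)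
  set r := Real.sqrt 2 with hr
  have hr2 : r ^ 2 = 2 := Real.sq_sqrt (by norm_num)
  -- A relation valid for the monomials `x⁵, x³y², x³z², xy⁴, xy²z², xz⁴`. All its points other than
  -- `e₀` are zeros of the decic.
  obtain ⟨c, hc⟩ : ∃ c : Fin 7 → ℝ, c = ![-2, r, 1, 1, -1, -1, -6] := ⟨_, rfl⟩
  obtain ⟨P, hP⟩ : ∃ P : Fin 7 → Fin 3 → ℝ, P = ![Pi.single 0 1, ![r, 1, 1], ![1, 1, r],
    ![1, r, 1], ![1, 1, 0], ![1, 0, 1], ![1, 1, 1]] := ⟨_, rfl⟩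
  have H : ∀ m : Fin 3 → ℕ, ∑ i, m i = 5 → Even (m 0 + 5) → (∀ i : Fin 2, Even (m i.succ)) →
      ∑ a, c a * ∏ i, P a i ^ m i = 0 := by
    intro m hm he ho
    obtain ⟨u, hu⟩ := ho 0
    obtain ⟨v, hv⟩ := ho 1
    have e1 : m 1 = 2 * u := by rw [two_mul]; exact hu
    have e2 : m 2 = 2 * v := by rw [two_mul]; exact hv
    have e0 : m 0 = 5 - 2 * u - 2 * v := by rw [Fin.sum_univ_three] at hm; omega
    have huv : u + v ≤ 2 := by rw [Fin.sum_univ_three] at hm; omega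
    have hr4 : r ^ 4 = 4 := by rw [show r ^ 4 = (r ^ 2) ^ 2 by ring, hr2]; norm_num
    have hrr : r * r = 2 := by rw [← sq, hr2]
    have hr3 : r * r ^ 3 = 4 := by rw [← hr4]; ring
    have hr5 : r * r ^ 5 = 8 := by
      rw [show r * r ^ 5 = (r ^ 2) ^ 3 by ring, hr2]; norm_num
    simp only [Fin.sum_univ_seven, Fin.prod_univ_three, e0, e1, e2, hc, hP]
    have hu2 : u ≤ 2 := by omega
    have hv2 : v ≤ 2 := by omega
    interval_cases u <;> interval_cases v <;> first | omega | skip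
    all_goals
      simp [hr2, hr4, hrr, hr3, hr5]
      try norm_num
  refine h1 (eval_single_eq_zero hh Finset.univ c P (a₀ := 0) (Finset.mem_univ _)
    (by rw [hc]; norm_num) (by rw [hP]; rfl) H ?_)
  · intro a _ ha ε hε
    subst hP
    refine h2 _ ?_
    rw [eval_ternaryDecic]
    simp only [mul_pow, hε, one_mul]
    fin_cases a
    · exact absurd rfl ha
    all_goals
      simp [hr2]
      try norm_num

theorem not_isSOSOfDegree_evenSextic_mul_ternaryDecic :
    ¬ IsSOSOfDegree 8 (evenSextic 3 1 * ternaryDecic) := fun h =>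
  not_isSOSOfDegree_ternaryDecic (IsSOSOfDegree.of_evenSextic_three_mul (d := 5) h)

theorem not_isSOSOfDegree_psum_mul_evenSextic_four :
    ¬ IsSOSOfDegree 4 (psum (Fin 4) ℝ 2 * evenSextic 4 2) := by
  intro hf
  have hev : ∀ x : Fin 4 → ℝ, eval x (psum (Fin 4) ℝ 2 * evenSextic 4 2) =
      (x 0 ^ 2 + x 1 ^ 2 + x 2 ^ 2 + x 3 ^ 2) * ((x 0 ^ 2 + x 1 ^ 2 + x 2 ^ 2 + x 3 ^ 2) ^ 3
        - 5 * ((x 0 ^ 2 + x 1 ^ 2 + x 2 ^ 2 + x 3 ^ 2) *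
          (x 0 ^ 4 + x 1 ^ 4 + x 2 ^ 4 + x 3 ^ 4))
        + 6 * (x 0 ^ 6 + x 1 ^ 6 + x 2 ^ 6 + x 3 ^ 6)) := by
    intro x
    simp only [evenSextic, map_add, map_sub, map_mul, map_pow, eval_C, eval_psum,
      Fin.sum_univ_four]
    push_cast
    ring
  obtain ⟨h, hh, h1, h2⟩ := hf.exists_form_ne_zero (x := Pi.single 0 1) (by
    rw [hev]; simp; norm_num)
  -- A relation valid for the monomials `x_i⁴` and `x_i² x_j²`. Apart from `e₀` it uses the `0, 1`
  -- points with two or three nonzero coordinates, where the sextic factor vanishes.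
  obtain ⟨c, hc⟩ : ∃ c : Fin 11 → ℝ, c = ![-3, 2, 2, 2, -1, -1, -1, -1, -1, -1, 2] := ⟨_, rfl⟩
  obtain ⟨P, hP⟩ : ∃ P : Fin 11 → Fin 4 → ℝ, P =
    ![Pi.single 0 1, ![1, 1, 0, 0], ![1, 0, 1, 0], ![1, 0, 0, 1],
      ![0, 1, 1, 0], ![0, 1, 0, 1], ![0, 0, 1, 1],
      ![1, 1, 1, 0], ![1, 1, 0, 1], ![1, 0, 1, 1], ![0, 1, 1, 1]] := ⟨_, rfl⟩
  have H : ∀ m : Fin 4 → ℕ, ∑ i, m i = 4 → Even (m 0 + 4) → (∀ i : Fin 3, Even (m i.succ)) →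
      ∑ a, c a * ∏ i, P a i ^ m i = 0 := by
    intro m hm he ho
    obtain ⟨u, hu⟩ := ho 0
    obtain ⟨v, hv⟩ := ho 1
    obtain ⟨w, hw⟩ := ho 2
    have e1 : m 1 = 2 * u := by rw [two_mul]; exact hu
    have e2 : m 2 = 2 * v := by rw [two_mul]; exact hv
    have e3 : m 3 = 2 * w := by rw [two_mul]; exact hw
    have e0 : m 0 = 4 - 2 * u - 2 * v - 2 * w := by rw [Fin.sum_univ_four] at hm; omega
    have huv : u + v + w ≤ 2 := by rw [Fin.sum_univ_four] at hm; omega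
    simp only [Fin.sum_univ_succ, Fin.prod_univ_four, e0, e1, e2, e3, hc, hP]
    have hu2 : u ≤ 2 := by omega
    have hv2 : v ≤ 2 := by omega
    have hw2 : w ≤ 2 := by omega
    interval_cases u <;> interval_cases v <;> interval_cases w <;> first | omega | skip
    all_goals
      simp
      try norm_num
  refine h1 (eval_single_eq_zero hh Finset.univ c P (a₀ := 0) (Finset.mem_univ _)
    (by rw [hc]; norm_num) (by rw [hP]; rfl) H ?_)
  · intro a _ ha ε hε
    subst hP
    refine h2 _ ?_
    have hε4 : ∀ i, ε i ^ 4 = 1 := fun i => by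
      rw [show ε i ^ 4 = (ε i ^ 2) ^ 2 by ring, hε, one_pow]
    have hε6 : ∀ i, ε i ^ 6 = 1 := fun i => by
      rw [show ε i ^ 6 = (ε i ^ 2) ^ 3 by ring, hε, one_pow]
    rw [hev]
    simp only [mul_pow, hε, hε4, hε6, one_mul]
    fin_cases a
    · exact absurd rfl ha
    all_goals
      simp
      try norm_num

theorem not_isSOSOfDegree_psum_mul_evenSextic {n : ℕ} (hn : 4 ≤ n) :
    ¬ IsSOSOfDegree 4 (psum (Fin n) ℝ 2 * evenSextic n 2) := by
  obtain ⟨m, rfl⟩ := Nat.exists_eq_add_of_le hn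
  intro hf
  have := hf.restrictVars
  rw [map_mul, restrictVars_evenSextic, restrictVars_psum _ _ two_ne_zero] at this
  exact not_isSOSOfDegree_psum_mul_evenSextic_four this

/-- The even symmetric quartic `n ∑ x_i⁴ - (∑ x_i²)²`. -/
noncomputable def evenVariance (n : ℕ) : MvPolynomial (Fin n) ℝ :=
  C (n : ℝ) * psum (Fin n) ℝ 4 - psum (Fin n) ℝ 2 ^ 2

/-- Set `N = m + 1` of the variables equal to 1 and let the other three run through `0, ±1`. The
sextic vanishes when `N + 1` or `N + 2` coordinates are nonzero, and the variance factor vanishes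
when all `N + 3` are. Only the centre, with `N` nonzero coordinates, gives a positive value. -/
theorem not_isSOSOfDegree_evenVariance_mul (m : ℕ) :
    ¬ IsSOSOfDegree 5 (evenVariance (m + 4) * evenSextic (m + 4) (m + 2)) := by
  intro hf
  set N : ℝ := m + 1 with hN
  have hN0 : 0 < N := by positivity
  set g : Fin (m + 4) → MvPolynomial (Fin 4) ℝ :=
    Fin.cons (X 1) (Fin.cons (X 2) (Fin.cons (X 3) fun _ => X 0)) with hg
  have hsum : ∀ (r : ℕ) (y : Fin 3 → ℝ),
      ∑ i, (eval (Fin.cons 1 y : Fin 4 → ℝ) (g i)) ^ r = N + (y 0 ^ r + y 1 ^ r + y 2 ^ r) := by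
    intro r y
    rw [Fin.sum_univ_succ, Fin.sum_univ_succ, Fin.sum_univ_succ]
    have e0 : (Fin.cons 1 y : Fin 4 → ℝ) 0 = 1 := rfl
    have e1 : (Fin.cons 1 y : Fin 4 → ℝ) 1 = y 0 := rfl
    have e2 : (Fin.cons 1 y : Fin 4 → ℝ) 2 = y 1 := rfl
    have e3 : (Fin.cons 1 y : Fin 4 → ℝ) 3 = y 2 := rfl
    simp only [hg, Fin.cons_zero, Fin.cons_succ, eval_X, e0, e1, e2, e3, one_pow,
      Finset.sum_const, Finset.card_univ, Fintype.card_fin, nsmul_eq_mul, mul_one]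
    push_cast
    ring
  have hf' := hf.aeval g (fun i => by
    refine Fin.cases ?_ (Fin.cases ?_ (Fin.cases ?_ fun i => ?_)) i <;>
      exact isHomogeneous_X _ _)
  have hev : ∀ y : Fin 3 → ℝ, eval (Fin.cons 1 y : Fin 4 → ℝ)
      (aeval g (evenVariance (m + 4) * evenSextic (m + 4) (m + 2))) =
      ((N + 3) * (N + (y 0 ^ 4 + y 1 ^ 4 + y 2 ^ 4)) - (N + (y 0 ^ 2 + y 1 ^ 2 + y 2 ^ 2)) ^ 2) *
      ((N + (y 0 ^ 2 + y 1 ^ 2 + y 2 ^ 2)) ^ 3 - (2 * (N + 1) + 1) *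
        ((N + (y 0 ^ 2 + y 1 ^ 2 + y 2 ^ 2)) * (N + (y 0 ^ 4 + y 1 ^ 4 + y 2 ^ 4))) +
        (N + 1) * (N + 2) * (N + (y 0 ^ 6 + y 1 ^ 6 + y 2 ^ 6))) := by
    intro y
    rw [eval_aeval]
    simp only [evenVariance, evenSextic, map_add, map_sub, map_mul, map_pow, eval_C, eval_psum,
      hsum, hN]
    push_cast
    ring
  obtain ⟨h, hh, h1, h2⟩ := hf'.exists_form_ne_zero (x := Fin.cons 1 0) (by
    rw [hev]
    have : (0 : ℝ) < N * 3 * (N * 2) := by positivity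
    refine ne_of_gt (this.trans_le (le_of_eq ?_))
    simp only [Pi.zero_apply]
    ring)
  refine h1 (eval_cons_one_zero_eq_zero (r := 3) (by norm_num) hh fun y hy hy0 => h2 _ ?_)
  rw [hev]
  rcases hy 0 with e0 | e0 | e0 <;> rcases hy 1 with e1 | e1 | e1 <;>
    rcases hy 2 with e2 | e2 | e2 <;> rw [e0, e1, e2]
  · exact absurd (_root_.funext fun i => by fin_cases i <;> simp [e0, e1, e2]) hy0
  all_goals ring

/-! ### All degrees in which the two cones differ. -/

/-- Some invariant non-negative form of degree `2 * d` in `n` variables is not a sum of squares. -/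
def HasNonnegNotSOS (n d : ℕ) : Prop :=
  ∃ f ∈ invariantNonnegCone n (2 * d) (reflectionGroupD n), ¬ IsSOSOfDegree d f

theorem IsNonnegative.mul {n : ℕ} {f g : MvPolynomial (Fin n) ℝ} (hf : IsNonnegative f)
    (hg : IsNonnegative g) : IsNonnegative (f * g) := fun x => by
  rw [map_mul]; exact mul_nonneg (hf x) (hg x)

theorem invariantNonnegCone.mul {n a b c : ℕ}
    {G : Subgroup (EuclideanSpace ℝ (Fin n) ≃ₗᵢ[ℝ] EuclideanSpace ℝ (Fin n))}
    {f g : MvPolynomial (Fin n) ℝ} (hf : f ∈ invariantNonnegCone n a G)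
    (hg : g ∈ invariantNonnegCone n b G) (h : a + b = c) : f * g ∈ invariantNonnegCone n c G :=
  ⟨h ▸ hf.1.mul hg.1, hf.2.1.mul hg.2.1, hf.2.2.mul hg.2.2⟩

theorem evenSextic_mem_invariantNonnegCone (n k : ℕ) :
    evenSextic n k ∈ invariantNonnegCone n 6 (reflectionGroupD n) :=
  ⟨isHomogeneous_evenSextic n k, IsInvariantUnder.evenSextic n k, isNonnegative_evenSextic n k⟩

theorem ternaryDecic_mem_invariantNonnegCone :
    ternaryDecic ∈ invariantNonnegCone 3 10 (reflectionGroupD 3) :=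
  ⟨isHomogeneous_ternaryDecic, IsInvariantUnder.ternaryDecic, isNonnegative_ternaryDecic⟩

theorem psum_two_mem_invariantNonnegCone (n : ℕ) :
    psum (Fin n) ℝ 2 ∈ invariantNonnegCone n 2 (reflectionGroupD n) :=
  ⟨isHomogeneous_psum n 2, IsInvariantUnder.psum_two_mul n 1, fun x => by
    rw [eval_psum]; positivity⟩

theorem isNonnegative_evenVariance (n : ℕ) : IsNonnegative (evenVariance n) := by
  intro x
  have h := sq_sum_le_card_mul_sum_sq (s := Finset.univ) (f := fun i : Fin n => x i ^ 2)
  simp only [← pow_mul, Finset.card_univ, Fintype.card_fin] at h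
  simp only [evenVariance, map_sub, map_mul, map_pow, eval_C, eval_psum]
  linarith

theorem evenVariance_mem_invariantNonnegCone (n : ℕ) :
    evenVariance n ∈ invariantNonnegCone n 4 (reflectionGroupD n) :=
  ⟨((isHomogeneous_psum n 4).C_mul _).sub ((isHomogeneous_psum n 2).pow 2),
    ((IsInvariantUnder.C _).mul (IsInvariantUnder.psum_two_mul n 2)).sub
      ((IsInvariantUnder.psum_two_mul n 1).pow 2), isNonnegative_evenVariance n⟩

theorem indefiniteQuartic_ne_zero {n : ℕ} (hn : 3 ≤ n) : indefiniteQuartic n ≠ 0 := by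
  intro h
  have h1 := congrArg (eval fun _ => (1 : ℝ)) h
  simp only [indefiniteQuartic, map_sub, map_mul, map_pow, map_ofNat, eval_psum, one_pow,
    Finset.sum_const, Finset.card_univ, Fintype.card_fin, nsmul_eq_mul, mul_one, map_zero] at h1
  have : (3 : ℝ) ≤ n := by exact_mod_cast hn
  nlinarith

theorem HasNonnegNotSOS.add_four {n d : ℕ} (hn : 3 ≤ n) (h : HasNonnegNotSOS n d) :
    HasNonnegNotSOS n (d + 4) := by
  obtain ⟨f, hf, hs⟩ := h
  refine ⟨indefiniteQuartic n ^ 2 * f, ?_, fun hsos => hs ?_⟩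
  · have hq : indefiniteQuartic n ^ 2 ∈ invariantNonnegCone n 8 (reflectionGroupD n) :=
      ⟨(isHomogeneous_indefiniteQuartic n).pow 2, (IsInvariantUnder.indefiniteQuartic n).pow 2,
        fun x => by rw [map_pow]; positivity⟩
    exact invariantNonnegCone.mul hq hf (by ring)
  · have hr : IsRealPrincipal (indefiniteQuartic n) := by
      obtain ⟨m, rfl⟩ := Nat.exists_eq_add_of_le' hn
      exact isRealPrincipal_indefiniteQuartic m
    refine IsSOSOfDegree.of_sq_mul hr (isHomogeneous_indefiniteQuartic n)
      (indefiniteQuartic_ne_zero hn) ?_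
    rwa [add_comm 4 d]

theorem hasNonnegNotSOS_three {n : ℕ} (hn : 3 ≤ n) : HasNonnegNotSOS n 3 :=
  ⟨_, evenSextic_mem_invariantNonnegCone n 2, not_isSOSOfDegree_evenSextic hn⟩

theorem hasNonnegNotSOS_four {n : ℕ} (hn : 4 ≤ n) : HasNonnegNotSOS n 4 :=
  ⟨_, invariantNonnegCone.mul (psum_two_mem_invariantNonnegCone n)
    (evenSextic_mem_invariantNonnegCone n 2) rfl, not_isSOSOfDegree_psum_mul_evenSextic hn⟩

theorem hasNonnegNotSOS_five {n : ℕ} (hn : 3 ≤ n) : HasNonnegNotSOS n 5 := by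
  rcases hn.eq_or_lt with rfl | hn
  · exact ⟨_, ternaryDecic_mem_invariantNonnegCone, not_isSOSOfDegree_ternaryDecic⟩
  · obtain ⟨m, rfl⟩ := Nat.exists_eq_add_of_le' (Nat.succ_le_of_lt hn)
    exact ⟨_, invariantNonnegCone.mul (evenVariance_mem_invariantNonnegCone _)
      (evenSextic_mem_invariantNonnegCone _ (m + 2)) rfl, not_isSOSOfDegree_evenVariance_mul m⟩

theorem hasNonnegNotSOS_six {n : ℕ} (hn : 3 ≤ n) : HasNonnegNotSOS n 6 :=
  ⟨_, invariantNonnegCone.mul (evenSextic_mem_invariantNonnegCone n 1)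
    (evenSextic_mem_invariantNonnegCone n 2) rfl, not_isSOSOfDegree_evenSextic_mul hn⟩

theorem hasNonnegNotSOS_three_eight : HasNonnegNotSOS 3 8 :=
  ⟨_, invariantNonnegCone.mul (evenSextic_mem_invariantNonnegCone 3 1)
    ternaryDecic_mem_invariantNonnegCone rfl, not_isSOSOfDegree_evenSextic_mul_ternaryDecic⟩

/-- Steps of 4 in `d` start from `3, 4, 5, 6`. For `n = 3` the start `d = 4` is missing, so `d = 8`
needs its own form. -/
theorem hasNonnegNotSOS {n d : ℕ} (hn : 3 ≤ n) (hd : 3 ≤ d) (h : ¬ (n = 3 ∧ d = 4)) :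
    HasNonnegNotSOS n d := by
  induction d using Nat.strong_induction_on with
  | _ d ih =>
    by_cases h3 : d = 3
    · exact h3 ▸ hasNonnegNotSOS_three hn
    by_cases h4 : d = 4
    · exact h4 ▸ hasNonnegNotSOS_four (by omega)
    by_cases h5 : d = 5
    · exact h5 ▸ hasNonnegNotSOS_five hn
    by_cases h6 : d = 6
    · exact h6 ▸ hasNonnegNotSOS_six hn
    by_cases h8 : n = 3 ∧ d = 8
    · obtain ⟨rfl, rfl⟩ := h8
      exact hasNonnegNotSOS_three_eight
    have := (ih (d - 4) (by omega) (by omega) (by omega)).add_four hn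
    rwa [show d - 4 + 4 = d by omega] at this

/-! ### Forms in one and two variables. -/

theorem Polynomial.eval_nonneg_of_X_sub_C_sq_mul {r : ℝ} {p : Polynomial ℝ}
    (h : ∀ x, 0 ≤ ((X - C r) ^ 2 * p).eval x) (x : ℝ) : 0 ≤ p.eval x := by
  have hne : ∀ y, y ≠ r → 0 ≤ p.eval y := by
    intro y hy
    have h1 := h y
    simp only [eval_mul, eval_pow, eval_sub, eval_X, eval_C] at h1
    have h2 : 0 < (y - r) ^ 2 := by
      have := sub_ne_zero.2 hy
      positivity
    exact nonneg_of_mul_nonneg_right h1 h2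
  by_contra hx
  push Not at hx
  have hopen : IsOpen {y | p.eval y < 0} := isOpen_lt p.continuous continuous_const
  have : {y | p.eval y < 0} ⊆ {r} := fun y hy => by
    by_contra hyr
    exact absurd (hne y hyr) (not_le.2 hy)
  have hfin : {y | p.eval y < 0}.Finite := (Set.finite_singleton r).subset this
  exact infinite_of_mem_nhds x (hopen.mem_nhds hx) hfin

/-- Strong induction on the degree, splitting off the quadratic factor given by a complex root. The
degree bound is what allows each square to be homogenised later. -/
theorem Polynomial.exists_eq_sum_sq_of_nonneg (p : Polynomial ℝ) (hp : ∀ x, 0 ≤ p.eval x) :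
    ∃ (ι : Type) (_ : Fintype ι) (q : ι → Polynomial ℝ),
      (∀ k, 2 * (q k).natDegree ≤ p.natDegree) ∧ p = ∑ k, q k ^ 2 := by
  induction hn : p.natDegree using Nat.strong_induction_on generalizing p with
  | _ n ih =>
    by_cases h0 : n = 0
    · subst h0
      obtain ⟨c, rfl⟩ := Polynomial.natDegree_eq_zero.1 hn
      have hc : 0 ≤ c := by simpa using hp 0
      refine ⟨Unit, inferInstance, fun _ => C (Real.sqrt c), by simp, ?_⟩
      simp [← map_pow, Real.sq_sqrt hc]
    have hp0 : p ≠ 0 := by rintro rfl; simp at hn; omega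
    obtain ⟨z, hz⟩ : ∃ z : ℂ, aeval z p = 0 := by
      refine IsAlgClosed.exists_aeval_eq_zero ℂ p ?_
      rw [degree_eq_natDegree hp0, hn]
      exact_mod_cast h0
    by_cases him : z.im = 0
    · have hr : p.IsRoot z.re := by
        have : z = (z.re : ℂ) := by
          apply Complex.ext <;> simp [him]
        rw [this] at hz
        have h1 := Polynomial.aeval_algebraMap_apply ℂ z.re p
        rw [Complex.coe_algebraMap, hz] at h1
        exact_mod_cast h1.symm
      obtain ⟨q, hq⟩ := dvd_iff_isRoot.2 hr
      -- A simple real root would make `p` change sign, so a real root is at least double.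
      have hq0 : q.IsRoot z.re := by
        by_contra hne
        have hcont : ContinuousAt (fun x => q.eval x) z.re := q.continuous.continuousAt
        rcases lt_or_gt_of_ne hne with h | h
        · have hev := (hcont.eventually (gt_mem_nhds h))
          obtain ⟨ε, hε, hball⟩ := Metric.eventually_nhds_iff.1 hev
          have h1 := hball (y := z.re + ε / 2) (by
            rw [Real.dist_eq, add_sub_cancel_left, abs_of_pos (by linarith)]; linarith)
          have h2 := hp (z.re + ε / 2)
          rw [hq] at h2
          simp only [eval_mul, eval_sub, eval_X, eval_C, add_sub_cancel_left] at h2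
          nlinarith
        · have hev := (hcont.eventually (lt_mem_nhds h))
          obtain ⟨ε, hε, hball⟩ := Metric.eventually_nhds_iff.1 hev
          have h1 := hball (y := z.re - ε / 2) (by
            rw [Real.dist_eq, sub_sub_cancel_left, abs_neg, abs_of_pos (by linarith)]; linarith)
          have h2 := hp (z.re - ε / 2)
          rw [hq] at h2
          simp only [eval_mul, eval_sub, eval_X, eval_C, sub_sub_cancel_left] at h2
          nlinarith
      obtain ⟨s, hs⟩ := dvd_iff_isRoot.2 hq0
      have hps : p = (X - C z.re) ^ 2 * s := by rw [hq, hs]; ring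
      have hs0 : s ≠ 0 := by rintro rfl; simp at hps; exact hp0 hps
      have hdeg : p.natDegree = 2 + s.natDegree := by
        rw [hps, natDegree_mul (pow_ne_zero _ (X_sub_C_ne_zero _)) hs0, natDegree_pow,
          natDegree_X_sub_C]
      obtain ⟨ι, hι, t, ht1, ht2⟩ := ih s.natDegree (by omega) s
        (eval_nonneg_of_X_sub_C_sq_mul (r := z.re) (by rw [← hps]; exact hp)) rfl
      refine ⟨ι, hι, fun k => (X - C z.re) * t k, fun k => ?_, ?_⟩
      · have h1 := natDegree_mul_le (p := X - C z.re) (q := t k)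
        rw [natDegree_X_sub_C] at h1
        have := ht1 k
        dsimp only
        omega
      · simp only [mul_pow, ← Finset.mul_sum]
        rw [← ht2, ← hps]
    · obtain ⟨s, hs⟩ := quadratic_dvd_of_aeval_eq_zero_im_ne_zero p hz him
      -- The factor belonging to a conjugate pair is a sum of two squares.
      have hquad : (X ^ 2 - C (2 * z.re) * X + C (‖z‖ ^ 2) : Polynomial ℝ) =
          (X - C z.re) ^ 2 + C z.im ^ 2 := by
        rw [Complex.sq_norm, Complex.normSq_apply]
        simp only [map_add, map_mul, map_ofNat]
        ring
      rw [hquad] at hs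
      have hs0 : s ≠ 0 := by rintro rfl; simp at hs; exact hp0 hs
      have hdq : ((X - C z.re) ^ 2 + C z.im ^ 2 : Polynomial ℝ).natDegree = 2 := by
        rw [← hquad]; compute_degree!
      have hdeg : p.natDegree = 2 + s.natDegree := by
        rw [hs, natDegree_mul (fun h => by rw [h] at hdq; simp at hdq) hs0, hdq]
      obtain ⟨ι, hι, t, ht1, ht2⟩ := ih s.natDegree (by omega) s (fun x => by
        have h1 := hp x
        rw [hs] at h1
        simp only [eval_mul, eval_add, eval_pow, eval_sub, eval_X, eval_C] at h1
        have h2 : 0 < (x - z.re) ^ 2 + z.im ^ 2 := by positivity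
        exact nonneg_of_mul_nonneg_right h1 h2) rfl
      refine ⟨ι ⊕ ι, inferInstance,
        Sum.elim (fun k => (X - C z.re) * t k) fun k => C z.im * t k, ?_, ?_⟩
      · rintro (k | k)
        · have h1 := natDegree_mul_le (p := X - C z.re) (q := t k)
          rw [natDegree_X_sub_C] at h1
          have := ht1 k
          simp only [Sum.elim_inl]
          omega
        · have h1 := natDegree_C_mul_le z.im (t k)
          have := ht1 k
          simp only [Sum.elim_inr]
          omega
      · simp only [Fintype.sum_sum_type, Sum.elim_inl, Sum.elim_inr, mul_pow, ← Finset.mul_sum]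
        rw [← ht2, ← add_mul, ← hs]

/-- Set the second variable to 1, decompose the univariate polynomial, and homogenise each square
root to degree `d`. -/
theorem isSOSOfDegree_of_binary {d : ℕ} {f : MvPolynomial (Fin 2) ℝ}
    (hf : f.IsHomogeneous (2 * d)) (hnn : IsNonnegative f) : IsSOSOfDegree d f := by
  set p : Polynomial ℝ := aeval ![Polynomial.X, 1] f with hp
  have hdeg : p.natDegree ≤ 2 * d := by
    have := MvPolynomial.aeval_natDegree_le f hf.totalDegree_le
      (![Polynomial.X, 1] : Fin 2 → Polynomial ℝ) (n := 1) (by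
        intro i; fin_cases i <;> simp)
    simpa using this
  have hev : ∀ x, p.eval x = eval ![x, 1] f := by
    intro x
    have h1 : ∀ g : MvPolynomial (Fin 2) ℝ,
        (aeval ![Polynomial.X, 1] g : Polynomial ℝ).eval x = eval ![x, 1] g := by
      intro g
      induction g using MvPolynomial.induction_on with
      | C a => simp
      | add a b ha hb => rw [map_add, map_add, Polynomial.eval_add, ha, hb]
      | mul_X a i ha =>
        rw [map_mul, map_mul, Polynomial.eval_mul, ha, aeval_X, eval_X]
        fin_cases i <;> simp
    exact h1 f
  obtain ⟨ι, hι, q, hq1, hq2⟩ := p.exists_eq_sum_sq_of_nonneg fun x => by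
    rw [hev]; exact hnn _
  refine ⟨ι, hι, fun k => (q k).homogenize d, fun k => Polynomial.isHomogeneous_homogenize _, ?_⟩
  rw [← Polynomial.homogenize_eq_of_isHomogeneous hf hp.symm, hq2, Polynomial.homogenize_finsetSum]
  refine Finset.sum_congr rfl fun k _ => ?_
  have hk : (q k).natDegree ≤ d := by
    have := hq1 k
    omega
  rw [sq, sq, two_mul, Polynomial.homogenize_mul _ _ hk hk]

theorem isSOSOfDegree_of_unary {d : ℕ} {f : MvPolynomial (Fin 1) ℝ}
    (hf : f.IsHomogeneous (2 * d)) (hnn : IsNonnegative f) : IsSOSOfDegree d f := by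
  have h : f = C (eval (fun _ => 1) f) * (X 0 ^ d) ^ 2 := by
    refine MvPolynomial.funext fun x => ?_
    have h1 := hf.eval_mul (x 0) fun _ => 1
    have h2 : (fun i : Fin 1 => x 0 * (1 : ℝ)) = x := by
      ext i; rw [Subsingleton.elim i 0, mul_one]
    rw [h2] at h1
    rw [h1]
    simp only [map_mul, map_pow, eval_C, eval_X]
    ring
  rw [h]
  exact (IsSOSOfDegree.sq (isHomogeneous_X_pow 0 d)).C_mul (hnn _)

/-! ### Invariant quadratic and quartic forms. -/

section Invariant

variable {n d : ℕ} {f : MvPolynomial (Fin n) ℝ}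

theorem IsInvariantUnder.coeff_perm (hf : IsInvariantUnder (reflectionGroupD n) f)
    (π : Equiv.Perm (Fin n)) (m : Fin n →₀ ℕ) : coeff (m.mapDomain π) f = coeff m f := by
  induction π using Equiv.Perm.swap_induction_on generalizing m with
  | one =>
    have : m.mapDomain ((1 : Equiv.Perm (Fin n)) : Fin n → Fin n) = m := Finsupp.mapDomain_id
    rw [this]
  | swap_mul π i j hij ih =>
    rw [Equiv.Perm.coe_mul, Finsupp.mapDomain_comp, hf.coeff_swap hij, ih]

theorem IsInvariantUnder.even_or_odd (hf : IsInvariantUnder (reflectionGroupD n) f)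
    {m : Fin n →₀ ℕ} (hm : coeff m f ≠ 0) : (∀ i, Even (m i)) ∨ ∀ i, Odd (m i) := by
  by_contra h
  push Not at h
  obtain ⟨⟨i, hi⟩, ⟨j, hj⟩⟩ := h
  rw [Nat.not_even_iff_odd] at hi
  rw [Nat.not_odd_iff_even] at hj
  have hij : i ≠ j := by
    rintro rfl
    exact (Nat.not_even_iff_odd.2 hi) hj
  exact hm (hf.coeff_eq_zero hij (hi.add_even hj))

theorem exists_perm_pair {i j k l : Fin n} (hij : i ≠ j) (hkl : k ≠ l) :
    ∃ π : Equiv.Perm (Fin n), π i = k ∧ π j = l := by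
  refine ⟨Equiv.swap l (Equiv.swap k i j) * Equiv.swap k i, ?_, ?_⟩
  · rw [Equiv.Perm.mul_apply, Equiv.swap_apply_right]
    refine Equiv.swap_apply_of_ne_of_ne hkl fun h => hij ?_
    refine (Equiv.swap k i).injective ?_
    rw [Equiv.swap_apply_right]
    exact h
  · rw [Equiv.Perm.mul_apply, Equiv.swap_apply_right]

theorem exists_eq_single_of_sum_eq_two {m : Fin n →₀ ℕ} (hm : ∑ i, m i = 2)
    (he : ∀ i, Even (m i)) : ∃ i, m = Finsupp.single i 2 := by
  classical
  have hex : ∃ i, m i ≠ 0 := by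
    by_contra h
    push Not at h
    simp [h] at hm
  obtain ⟨i, hi⟩ := hex
  rw [← Finset.add_sum_erase _ _ (Finset.mem_univ i)] at hm
  obtain ⟨k, hk⟩ := he i
  have h0 : ∑ j ∈ Finset.univ.erase i, m j = 0 := by omega
  rw [Finset.sum_eq_zero_iff] at h0
  refine ⟨i, Finsupp.ext fun j => ?_⟩
  by_cases hj : j = i
  · subst hj
    rw [Finsupp.single_eq_same]; omega
  · rw [Finsupp.single_eq_of_ne hj]
    exact h0 j (Finset.mem_erase.2 ⟨hj, Finset.mem_univ j⟩)

theorem exists_eq_single_add_single_of_sum_eq_four {m : Fin n →₀ ℕ} (hm : ∑ i, m i = 4)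
    (he : ∀ i, Even (m i)) : ∃ i j, m = Finsupp.single i 2 + Finsupp.single j 2 := by
  classical
  have hex : ∃ i, m i ≠ 0 := by
    by_contra h
    push Not at h
    simp [h] at hm
  obtain ⟨i, hi⟩ := hex
  have hi2 : 2 ≤ m i := by
    obtain ⟨k, hk⟩ := he i
    omega
  have hle : Finsupp.single i 2 ≤ m := Finsupp.single_le_iff.2 hi2
  have hsub : m - Finsupp.single i 2 + Finsupp.single i 2 = m := tsub_add_cancel_of_le hle
  obtain ⟨j, hj⟩ := exists_eq_single_of_sum_eq_two (m := m - Finsupp.single i 2) (by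
      have h1 : ∑ k, (m - Finsupp.single i 2 + Finsupp.single i 2 : Fin n →₀ ℕ) k = 4 := by rw [hsub]; exact hm
      simp only [Finsupp.add_apply, Finset.sum_add_distrib] at h1
      have h2 : ∑ k, (Finsupp.single i 2 : Fin n →₀ ℕ) k = 2 := by
        simp [Finsupp.single_apply]
      omega) (fun k => by
      rw [Finsupp.tsub_apply]
      by_cases hk : k = i
      · subst hk
        rw [Finsupp.single_eq_same]
        exact (Nat.even_sub hi2).2 (iff_of_true (he _) even_two)
      · rw [Finsupp.single_eq_of_ne hk, tsub_zero]
        exact he k)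
  exact ⟨j, i, by rw [← hj, hsub]⟩

theorem coeff_psum {r : ℕ} (m : Fin n →₀ ℕ) :
    coeff m (psum (Fin n) ℝ r) = ∑ i, if Finsupp.single i r = m then 1 else 0 := by
  classical
  simp only [psum, coeff_sum, coeff_X_pow]

theorem coeff_psum_two_sq (m : Fin n →₀ ℕ) :
    coeff m (psum (Fin n) ℝ 2 ^ 2) =
      ∑ i, ∑ j, if Finsupp.single i 2 + Finsupp.single j 2 = m then 1 else 0 := by
  classical
  rw [sq, psum, Finset.sum_mul_sum, coeff_sum]
  simp only [coeff_sum, X_pow_eq_monomial, monomial_mul, coeff_monomial, mul_one]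

theorem eq_C_mul_psum_of_quadratic (hn : 3 ≤ n) (hf : IsInvariantUnder (reflectionGroupD n) f)
    (hh : f.IsHomogeneous 2) : ∃ c : ℝ, f = C c * psum (Fin n) ℝ 2 := by
  classical
  let i₀ : Fin n := ⟨0, by omega⟩
  set c := coeff (Finsupp.single i₀ 2) f with hc
  refine ⟨c, ?_⟩
  rw [← sub_eq_zero]
  set g := f - C c * psum (Fin n) ℝ 2 with hg
  have hgi : IsInvariantUnder (reflectionGroupD n) g :=
    hf.sub ((IsInvariantUnder.C c).mul (IsInvariantUnder.psum_two_mul n 1))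
  have hgh : g.IsHomogeneous 2 := hh.sub ((isHomogeneous_psum n 2).C_mul c)
  have h0 : coeff (Finsupp.single i₀ 2) g = 0 := by
    rw [hg, coeff_sub, coeff_C_mul, coeff_psum]
    have : ∀ i : Fin n, (Finsupp.single i 2 = (Finsupp.single i₀ 2 : Fin n →₀ ℕ)) ↔ i = i₀ :=
      fun i => Finsupp.single_left_inj two_ne_zero
    simp [this, hc]
  ext m
  rw [coeff_zero]
  by_contra hm
  have hs := hgh.sum_eq_of_mem_support (mem_support_iff.2 hm)
  rcases hgi.even_or_odd hm with he | ho
  · obtain ⟨i, rfl⟩ := exists_eq_single_of_sum_eq_two hs he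
    rw [← hgi.coeff_perm (Equiv.swap i i₀), Finsupp.mapDomain_single, Equiv.swap_apply_left] at hm
    exact hm h0
  · have : ∑ _i : Fin n, 1 ≤ ∑ i, m i := Finset.sum_le_sum fun i _ => (ho i).pos
    simp at this
    omega

theorem coeff_eq_zero_of_quartic (hf : IsInvariantUnder (reflectionGroupD n) f)
    {i₀ i₁ : Fin n} (hi : i₀ ≠ i₁) (h0 : coeff (Finsupp.single i₀ 2 + Finsupp.single i₀ 2) f = 0)
    (h1 : coeff (Finsupp.single i₀ 2 + Finsupp.single i₁ 2) f = 0) {m : Fin n →₀ ℕ}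
    (hs : ∑ i, m i = 4) (he : ∀ i, Even (m i)) : coeff m f = 0 := by
  obtain ⟨i, j, rfl⟩ := exists_eq_single_add_single_of_sum_eq_four hs he
  by_cases hij : i = j
  · subst hij
    rw [← hf.coeff_perm (Equiv.swap i i₀), Finsupp.mapDomain_add, Finsupp.mapDomain_single,
      Equiv.swap_apply_left, h0]
  · obtain ⟨π, hπ1, hπ2⟩ := exists_perm_pair hij hi
    rw [← hf.coeff_perm π, Finsupp.mapDomain_add, Finsupp.mapDomain_single,
      Finsupp.mapDomain_single, hπ1, hπ2, h1]

theorem exists_quartic_coeff (hf : IsInvariantUnder (reflectionGroupD n) f)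
    (hh : f.IsHomogeneous 4) {i₀ i₁ : Fin n} (hi : i₀ ≠ i₁) :
    ∃ α β : ℝ, IsInvariantUnder (reflectionGroupD n)
        (f - (C α * psum (Fin n) ℝ 4 + C β * psum (Fin n) ℝ 2 ^ 2)) ∧
      (f - (C α * psum (Fin n) ℝ 4 + C β * psum (Fin n) ℝ 2 ^ 2)).IsHomogeneous 4 ∧
      ∀ m : Fin n →₀ ℕ, (∀ i, Even (m i)) →
        coeff m (f - (C α * psum (Fin n) ℝ 4 + C β * psum (Fin n) ℝ 2 ^ 2)) = 0 := by
  classical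
  set a := coeff (Finsupp.single i₀ 2 + Finsupp.single i₀ 2) f with ha
  set b := coeff (Finsupp.single i₀ 2 + Finsupp.single i₁ 2) f with hb
  -- In `psum 2 ^ 2` the coefficient of `x_i⁴` is 1 and that of `x_i² x_j²` is 2, while `psum 4` has
  -- no mixed terms.
  refine ⟨a - b / 2, b / 2, ?_⟩
  set g := f - (C (a - b / 2) * psum (Fin n) ℝ 4 + C (b / 2) * psum (Fin n) ℝ 2 ^ 2) with hg
  have hgi : IsInvariantUnder (reflectionGroupD n) g :=
    hf.sub (((IsInvariantUnder.C _).mul (IsInvariantUnder.psum_two_mul n 2)).add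
      ((IsInvariantUnder.C _).mul ((IsInvariantUnder.psum_two_mul n 1).pow 2)))
  have hgh : g.IsHomogeneous 4 := hh.sub (((isHomogeneous_psum n 4).C_mul _).add
    (((isHomogeneous_psum n 2).pow 2).C_mul _))
  refine ⟨hgi, hgh, fun m he => ?_⟩
  by_cases hs : ∑ i, m i = 4
  swap
  · by_contra hm
    exact hs (hgh.sum_eq_of_mem_support (mem_support_iff.2 hm))
  refine coeff_eq_zero_of_quartic hgi hi ?_ ?_ hs he
  · rw [hg, coeff_sub, coeff_add, coeff_C_mul, coeff_C_mul, coeff_psum, coeff_psum_two_sq, ← ha]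
    have e1 : ∀ i : Fin n, (Finsupp.single i 4 =
        (Finsupp.single i₀ 2 + Finsupp.single i₀ 2 : Fin n →₀ ℕ)) ↔ i = i₀ := by
      intro i
      rw [← Finsupp.single_add]
      exact Finsupp.single_left_inj four_ne_zero
    have e2 : ∀ i j : Fin n, (Finsupp.single i 2 + Finsupp.single j 2 =
        (Finsupp.single i₀ 2 + Finsupp.single i₀ 2 : Fin n →₀ ℕ)) ↔ (i = i₀ ∧ j = i₀) := by
      intro i j
      constructor
      · intro h
        have := DFunLike.congr_fun h i₀
        simp only [Finsupp.add_apply, Finsupp.single_apply] at this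
        by_cases h1 : i = i₀ <;> by_cases h2 : j = i₀ <;> simp [h1, h2] at this ⊢
      · rintro ⟨rfl, rfl⟩; rfl
    simp [e1, e2, ite_and]
  · rw [hg, coeff_sub, coeff_add, coeff_C_mul, coeff_C_mul, coeff_psum, coeff_psum_two_sq, ← hb]
    have e1 : ∀ i : Fin n, ¬ (Finsupp.single i 4 =
        (Finsupp.single i₀ 2 + Finsupp.single i₁ 2 : Fin n →₀ ℕ)) := by
      intro i h
      have h1 := DFunLike.congr_fun h i₀
      simp only [Finsupp.add_apply, Finsupp.single_apply] at h1
      split_ifs at h1 <;> simp_all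
    have e2 : ∀ i j : Fin n, (Finsupp.single i 2 + Finsupp.single j 2 =
        (Finsupp.single i₀ 2 + Finsupp.single i₁ 2 : Fin n →₀ ℕ)) ↔
          ((i = i₀ ∧ j = i₁) ∨ (i = i₁ ∧ j = i₀)) := by
      intro i j
      constructor
      · intro h
        have h1 := DFunLike.congr_fun h i₀
        have h2 := DFunLike.congr_fun h i₁
        simp only [Finsupp.add_apply, Finsupp.single_apply] at h1 h2
        clear_value g a b
        clear hgi hgh ha hb hg hh hf he
        grind
      · rintro (⟨rfl, rfl⟩ | ⟨rfl, rfl⟩)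
        · rfl
        · rw [add_comm]
    have e3 : ∀ i j : Fin n, (if (i = i₀ ∧ j = i₁) ∨ (i = i₁ ∧ j = i₀) then (1 : ℝ) else 0) =
        (if i = i₀ then (if j = i₁ then 1 else 0) else 0) +
          (if i = i₁ then (if j = i₀ then 1 else 0) else 0) := by
      intro i j
      clear e1 e2 hgi hgh hg
      grind
    simp only [e1, e2, e3, Finset.sum_add_distrib]
    simp
    ring

theorem isSOSOfDegree_psum_two : IsSOSOfDegree 1 (psum (Fin n) ℝ 2) :=
  IsSOSOfDegree.sum _ _ fun i _ => IsSOSOfDegree.sq (isHomogeneous_X _ i)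

theorem isSOSOfDegree_psum_four : IsSOSOfDegree 2 (psum (Fin n) ℝ 4) :=
  IsSOSOfDegree.sum _ _ fun i _ => by
    rw [show (X i : MvPolynomial (Fin n) ℝ) ^ 4 = (X i ^ 2) ^ 2 by ring]
    exact IsSOSOfDegree.sq (isHomogeneous_X_pow i 2)

theorem isSOSOfDegree_evenVariance : IsSOSOfDegree 2 (evenVariance n) := by
  have h : evenVariance n =
      C (1 / 2) * ∑ i : Fin n, ∑ j : Fin n, ((X i : MvPolynomial (Fin n) ℝ) ^ 2 - X j ^ 2) ^ 2 := by
    refine MvPolynomial.funext fun x => ?_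
    simp only [evenVariance, map_sub, map_mul, map_pow, map_sum, eval_C, eval_psum, eval_X]
    have : ∀ i j, (x i ^ 2 - x j ^ 2) ^ 2 = x i ^ 4 + x j ^ 4 - 2 * (x i ^ 2 * x j ^ 2) :=
      fun i j => by ring
    simp only [this, Finset.sum_sub_distrib, Finset.sum_add_distrib, ← Finset.mul_sum,
      ← Finset.sum_mul, Finset.sum_const, Finset.card_univ, Fintype.card_fin, nsmul_eq_mul]
    ring
  rw [h]
  exact (IsSOSOfDegree.sum _ _ fun i _ => IsSOSOfDegree.sum _ _ fun j _ =>
    IsSOSOfDegree.sq ((isHomogeneous_X_pow i 2).sub (isHomogeneous_X_pow j 2))).C_mul (by norm_num)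

theorem isSOSOfDegree_psum_sq_sub : IsSOSOfDegree 2 (psum (Fin n) ℝ 2 ^ 2 - psum (Fin n) ℝ 4) := by
  classical
  have h : psum (Fin n) ℝ 2 ^ 2 - psum (Fin n) ℝ 4 =
      ∑ i : Fin n, ∑ j ∈ Finset.univ.erase i, ((X i : MvPolynomial (Fin n) ℝ) * X j) ^ 2 := by
    rw [sub_eq_iff_eq_add, psum, psum, sq, Finset.sum_mul_sum, ← Finset.sum_add_distrib]
    refine Finset.sum_congr rfl fun i _ => ?_
    rw [← Finset.add_sum_erase _ _ (Finset.mem_univ i), add_comm]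
    simp only [mul_pow]
    ring
  rw [h]
  exact IsSOSOfDegree.sum _ _ fun i _ => IsSOSOfDegree.sum _ _ fun j _ =>
    IsSOSOfDegree.sq ((isHomogeneous_X _ i).mul (isHomogeneous_X _ j))

theorem eval_psum_single {r : ℕ} (hr : r ≠ 0) (i : Fin n) :
    eval (Pi.single i 1) (psum (Fin n) ℝ r) = 1 := by
  rw [eval_psum, Finset.sum_eq_single i]
  · simp
  · intro j _ hj; simp [hj, hr]
  · simp

theorem isSOSOfDegree_of_quadratic (hn : 3 ≤ n) (hf : IsInvariantUnder (reflectionGroupD n) f)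
    (hh : f.IsHomogeneous 2) (hnn : IsNonnegative f) : IsSOSOfDegree 1 f := by
  obtain ⟨c, rfl⟩ := eq_C_mul_psum_of_quadratic hn hf hh
  refine isSOSOfDegree_psum_two.C_mul ?_
  have := hnn (Pi.single ⟨0, by omega⟩ 1)
  rwa [map_mul, eval_C, eval_psum_single two_ne_zero, mul_one] at this

/-- The values at a unit vector and at the all-ones vector give `α + β ≥ 0` and `α + n β ≥ 0`. By
the sign of `β`, the form is a non-negative combination of `psum 4` with `psum 2 ^ 2 - psum 4` or
with `evenVariance`. -/
theorem isSOSOfDegree_psum_combination (hn : 1 ≤ n) {α β : ℝ}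
    (hnn : IsNonnegative (C α * psum (Fin n) ℝ 4 + C β * psum (Fin n) ℝ 2 ^ 2)) :
    IsSOSOfDegree 2 (C α * psum (Fin n) ℝ 4 + C β * psum (Fin n) ℝ 2 ^ 2) := by
  have h1 := hnn (Pi.single ⟨0, by omega⟩ 1)
  simp only [map_add, map_mul, map_pow, eval_C, eval_psum_single two_ne_zero,
    eval_psum_single four_ne_zero] at h1
  have h2 := hnn fun _ => 1
  simp only [map_add, map_mul, map_pow, eval_C, eval_psum, one_pow, Finset.sum_const,
    Finset.card_univ, Fintype.card_fin, nsmul_eq_mul, mul_one] at h2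
  have hn' : (1 : ℝ) ≤ n := by exact_mod_cast hn
  rcases le_or_gt 0 β with hβ | hβ
  · have := (isSOSOfDegree_psum_sq_sub (n := n)).C_mul hβ |>.add
      ((isSOSOfDegree_psum_four (n := n)).C_mul (c := α + β) (by linarith))
    convert this using 1
    simp only [map_add]
    ring
  · have := (isSOSOfDegree_evenVariance (n := n)).C_mul (c := -β) (by linarith) |>.add
      ((isSOSOfDegree_psum_four (n := n)).C_mul (c := α + β * n) (by nlinarith))
    convert this using 1
    simp only [evenVariance, map_add, map_neg, map_mul]
    ring

/-- The cone is simplicial. Each of the three sums of squares `evenVariance`, `e1`, `e2` vanishes at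
two of the points `(1,0,0,0)`, `(1,1,1,1)`, `(1,1,1,-1)`, so its coefficient is the value of `f` at
the third, divided by 3 or 12. -/
theorem isSOSOfDegree_of_quartic_four {f : MvPolynomial (Fin 4) ℝ} {α β γ : ℝ}
    (hf : f = C α * psum (Fin 4) ℝ 4 + C β * psum (Fin 4) ℝ 2 ^ 2
      + C γ * (X 0 * X 1 * X 2 * X 3)) (hnn : IsNonnegative f) : IsSOSOfDegree 2 f := by
  have h1 : 0 ≤ α + β := by
    have := hnn (Pi.single 0 1)
    rw [hf] at this
    simpa [eval_psum_single] using this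
  have h2 : 0 ≤ 4 * α + 16 * β + γ := by
    have := hnn ![1, 1, 1, 1]
    rw [hf] at this
    simp only [map_add, map_mul, map_pow, eval_C, eval_psum, eval_X, Fin.sum_univ_four,
      Matrix.cons_val] at this
    norm_num at this
    linarith
  have h3 : 0 ≤ 4 * α + 16 * β - γ := by
    have := hnn ![1, 1, 1, -1]
    rw [hf] at this
    simp only [map_add, map_mul, map_pow, eval_C, eval_psum, eval_X, Fin.sum_univ_four,
      Matrix.cons_val] at this
    norm_num at this
    linarith
  have hX : ∀ i j : Fin 4, (X i * X j : MvPolynomial (Fin 4) ℝ).IsHomogeneous 2 := fun i j =>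
    (isHomogeneous_X _ i).mul (isHomogeneous_X _ j)
  have e1 : IsSOSOfDegree 2 (((X 0 * X 1 + X 2 * X 3) ^ 2 + (X 0 * X 2 + X 1 * X 3) ^ 2 +
      (X 0 * X 3 + X 1 * X 2) ^ 2 : MvPolynomial (Fin 4) ℝ)) :=
    ((IsSOSOfDegree.sq ((hX 0 1).add (hX 2 3))).add (IsSOSOfDegree.sq ((hX 0 2).add (hX 1 3)))).add
      (IsSOSOfDegree.sq ((hX 0 3).add (hX 1 2)))
  have e2 : IsSOSOfDegree 2 (((X 0 * X 1 - X 2 * X 3) ^ 2 + (X 0 * X 2 - X 1 * X 3) ^ 2 +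
      (X 0 * X 3 - X 1 * X 2) ^ 2 : MvPolynomial (Fin 4) ℝ)) :=
    ((IsSOSOfDegree.sq ((hX 0 1).sub (hX 2 3))).add (IsSOSOfDegree.sq ((hX 0 2).sub (hX 1 3)))).add
      (IsSOSOfDegree.sq ((hX 0 3).sub (hX 1 2)))
  have key := (((isSOSOfDegree_evenVariance (n := 4)).C_mul (c := (α + β) / 3) (by linarith)).add
    (e1.C_mul (c := (4 * α + 16 * β + γ) / 12) (by linarith))).add
    (e2.C_mul (c := (4 * α + 16 * β - γ) / 12) (by linarith))
  convert key using 1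
  rw [hf]
  refine MvPolynomial.funext fun x => ?_
  simp only [evenVariance, map_add, map_sub, map_mul, map_pow, eval_C, eval_psum, eval_X,
    Fin.sum_univ_four]
  push_cast
  ring

theorem isSOSOfDegree_of_quartic (hn : 3 ≤ n) (hf : IsInvariantUnder (reflectionGroupD n) f)
    (hh : f.IsHomogeneous 4) (hnn : IsNonnegative f) : IsSOSOfDegree 2 f := by
  classical
  obtain ⟨α, β, hgi, hgh, hg⟩ := exists_quartic_coeff hf hh (i₀ := ⟨0, by omega⟩)
    (i₁ := ⟨1, by omega⟩) (by simp)
  set g := f - (C α * psum (Fin n) ℝ 4 + C β * psum (Fin n) ℝ 2 ^ 2) with hgdef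
  -- Only monomials with all exponents odd remain; in degree 4 with `n ≥ 3` the only one is
  -- `x₀x₁x₂x₃`, for `n = 4`.
  have hodd : ∀ m : Fin n →₀ ℕ, coeff m g ≠ 0 → n = 4 ∧ ∀ i, m i = 1 := by
    intro m hm
    have hs := hgh.sum_eq_of_mem_support (mem_support_iff.2 hm)
    rcases hgi.even_or_odd hm with he | ho
    · exact absurd (hg m he) hm
    · have h1 : ∑ _i : Fin n, 1 ≤ ∑ i, m i := Finset.sum_le_sum fun i _ => (ho i).pos
      simp only [Finset.sum_const, Finset.card_univ, Fintype.card_fin, smul_eq_mul, mul_one] at h1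
      have h4 : n = 4 := by
        by_contra hne
        obtain rfl : n = 3 := by omega
        rw [Fin.sum_univ_three] at hs
        obtain ⟨a, ha⟩ := ho 0
        obtain ⟨b, hb⟩ := ho 1
        obtain ⟨c, hc⟩ := ho 2
        omega
      refine ⟨h4, fun i => ?_⟩
      have h5 : ∑ i, (m i - 1) = 0 := by
        have h6 : ∑ i, (m i - 1 + 1) = ∑ i, m i :=
          Finset.sum_congr rfl fun i _ => Nat.sub_add_cancel (ho i).pos
        rw [Finset.sum_add_distrib, hs] at h6
        simp at h6
        omega
      have h7 := (Finset.sum_eq_zero_iff.1 h5) i (Finset.mem_univ i)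
      have := (ho i).pos
      omega
  by_cases h4 : n = 4
  · subst h4
    set γ := coeff (Finsupp.equivFunOnFinite.symm fun _ => 1) g with hγ
    have hgX : g = C γ * (X 0 * X 1 * X 2 * X 3) := by
      have hmon : (X 0 * X 1 * X 2 * X 3 : MvPolynomial (Fin 4) ℝ) =
          monomial (Finsupp.equivFunOnFinite.symm fun _ => 1) 1 := by
        rw [monomial_eq, Finsupp.prod_fintype _ _ (fun _ => pow_zero _), Fin.prod_univ_four]
        simp
      ext m
      rw [coeff_C_mul, hmon, coeff_monomial]
      split_ifs with h
      · rw [← h, mul_one, hγ]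
      · rw [mul_zero]
        by_contra hm
        exact h (Finsupp.ext fun i => by simp [(hodd m hm).2 i])
    refine isSOSOfDegree_of_quartic_four (α := α) (β := β) (γ := γ) ?_ hnn
    rw [← hgX, hgdef]
    ring
  · have hg0 : g = 0 := by
      ext m
      rw [coeff_zero]
      by_contra hm
      exact h4 (hodd m hm).1
    rw [hgdef, sub_eq_zero] at hg0
    rw [hg0] at hnn ⊢
    exact isSOSOfDegree_psum_combination (by omega) hnn

end Invariant

/-! ### Ternary invariant octics: the four-parameter cone. -/

/-- Gives the largest multiple of `q` that can be subtracted from `h`, together with a point of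
contact. -/
theorem exists_mul_le_of_continuous {a b : ℝ} (hab : a ≤ b) {h q : ℝ → ℝ} (hh : Continuous h)
    (hq : Continuous q) (hpos : ∀ w ∈ Set.Icc a b, 0 < q w) :
    ∃ c : ℝ, ∃ w₀ ∈ Set.Icc a b, (∀ w ∈ Set.Icc a b, c * q w ≤ h w) ∧ c * q w₀ = h w₀ := by
  have hcont : ContinuousOn (fun w => h w / q w) (Set.Icc a b) :=
    hh.continuousOn.div hq.continuousOn fun w hw => (hpos w hw).ne'
  obtain ⟨w₀, hw₀, hmin⟩ := isCompact_Icc.exists_isMinOn (Set.nonempty_Icc.2 hab) hcont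
  refine ⟨h w₀ / q w₀, w₀, hw₀, fun w hw => ?_, div_mul_cancel₀ _ (hpos w₀ hw₀).ne'⟩
  exact (le_div_iff₀ (hpos w hw)).1 (hmin hw)

section Quartic

variable {a b g₀ g₁ g₂ g₃ g₄ : ℝ}

theorem quartic_deriv_eq_zero {w₀ : ℝ} (hw₀ : w₀ ∈ Set.Ioo a b)
    (h : ∀ w ∈ Set.Icc a b, 0 ≤ g₀ + g₂ * w ^ 2 + g₃ * w ^ 3 + g₄ * w ^ 4)
    (h0 : g₀ + g₂ * w₀ ^ 2 + g₃ * w₀ ^ 3 + g₄ * w₀ ^ 4 = 0) :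
    2 * g₂ * w₀ + 3 * g₃ * w₀ ^ 2 + 4 * g₄ * w₀ ^ 3 = 0 := by
  have hmin : IsLocalMin (fun w : ℝ => g₀ + g₂ * w ^ 2 + g₃ * w ^ 3 + g₄ * w ^ 4) w₀ := by
    filter_upwards [Icc_mem_nhds hw₀.1 hw₀.2] with w hw
    rw [h0]
    exact h w hw
  have h2 := (hasDerivAt_pow 2 w₀).const_mul g₂
  have h3 := (hasDerivAt_pow 3 w₀).const_mul g₃
  have h4 := (hasDerivAt_pow 4 w₀).const_mul g₄
  have h5 := hmin.hasDerivAt_eq_zero (((h2.const_add g₀).add h3).add h4)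
  push_cast at h5
  linear_combination h5

theorem nonneg_of_forall_mul_sq_nonneg (hb : 0 < b)
    (h : ∀ w ∈ Set.Icc 0 b, 0 ≤ g₂ * w ^ 2 + g₃ * w ^ 3 + g₄ * w ^ 4) :
    ∀ w ∈ Set.Icc 0 b, 0 ≤ g₂ + g₃ * w + g₄ * w ^ 2 := by
  have hpos : ∀ w ∈ Set.Ioc 0 b, 0 ≤ g₂ + g₃ * w + g₄ * w ^ 2 := by
    intro w hw
    have h1 := h w ⟨hw.1.le, hw.2⟩
    have h2 : g₂ * w ^ 2 + g₃ * w ^ 3 + g₄ * w ^ 4 = w ^ 2 * (g₂ + g₃ * w + g₄ * w ^ 2) := by ring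
    rw [h2] at h1
    exact nonneg_of_mul_nonneg_right h1 (pow_pos hw.1 2)
  have hcl : IsClosed {w : ℝ | 0 ≤ g₂ + g₃ * w + g₄ * w ^ 2} :=
    isClosed_le continuous_const (by fun_prop)
  have := closure_minimal hpos hcl
  rw [closure_Ioc hb.ne] at this
  exact this

end Quartic

/-- The quadratic form `(a² + b² + c² - ab - bc - ca)` at `a = x²`, `b = y²`, `c = z²`. -/
noncomputable def squareSpread : MvPolynomial (Fin 3) ℝ :=
  X 0 ^ 4 + X 1 ^ 4 + X 2 ^ 4 - X 0 ^ 2 * X 1 ^ 2 - X 1 ^ 2 * X 2 ^ 2 - X 0 ^ 2 * X 2 ^ 2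

/-- Three times the deviation of `X i ^ 2` from the mean of the squares of the variables. -/
noncomputable def squareDeviation (i : Fin 3) : MvPolynomial (Fin 3) ℝ :=
  3 * X i ^ 2 - psum (Fin 3) ℝ 2

/-- The ternary even symmetric octics in a basis adapted to the diagonal `x² = y² = z²`. -/
noncomputable def symmetricOctic (g₀ g₂ g₃ g₄ : ℝ) : MvPolynomial (Fin 3) ℝ :=
  C g₀ * psum (Fin 3) ℝ 2 ^ 4 + C g₂ * (psum (Fin 3) ℝ 2 ^ 2 * squareSpread) +
    C (g₃ / 2) * (psum (Fin 3) ℝ 2 *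
      (squareDeviation 0 * squareDeviation 1 * squareDeviation 2)) + C g₄ * squareSpread ^ 2

theorem eval_symmetricOctic (g₀ g₂ g₃ g₄ : ℝ) (x : Fin 3 → ℝ) :
    eval x (symmetricOctic g₀ g₂ g₃ g₄) =
      (g₀ + g₂ + g₃ + g₄) * (x 0 ^ 8 + x 1 ^ 8 + x 2 ^ 8) +
      (4 * g₀ + g₂ - g₃ / 2 - 2 * g₄) * (x 0 ^ 6 * x 1 ^ 2 + x 0 ^ 2 * x 1 ^ 6 +
        x 1 ^ 6 * x 2 ^ 2 + x 1 ^ 2 * x 2 ^ 6 + x 0 ^ 6 * x 2 ^ 2 + x 0 ^ 2 * x 2 ^ 6) +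
      (6 * g₀ - 3 * g₃ + 3 * g₄) * (x 0 ^ 4 * x 1 ^ 4 + x 1 ^ 4 * x 2 ^ 4 + x 0 ^ 4 * x 2 ^ 4) +
      (12 * g₀ - 3 * g₂ + 3 * g₃) *
        (x 0 ^ 2 * x 1 ^ 2 * x 2 ^ 2 * (x 0 ^ 2 + x 1 ^ 2 + x 2 ^ 2)) := by
  simp only [symmetricOctic, squareSpread, squareDeviation, map_add, map_sub, map_mul, map_pow,
    eval_C, eval_X, eval_psum, Fin.sum_univ_three, map_ofNat]
  ring

/-- `symmetricOctic g₀ g₂ g₃ g₄` is a sum of squares of quartic forms. -/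
def IsSOSOctic (g₀ g₂ g₃ g₄ : ℝ) : Prop := IsSOSOfDegree 4 (symmetricOctic g₀ g₂ g₃ g₄)

namespace IsSOSOctic

variable {g₀ g₂ g₃ g₄ : ℝ}

theorem add {h₀ h₂ h₃ h₄ : ℝ} (hg : IsSOSOctic g₀ g₂ g₃ g₄) (hh : IsSOSOctic h₀ h₂ h₃ h₄) :
    IsSOSOctic (g₀ + h₀) (g₂ + h₂) (g₃ + h₃) (g₄ + h₄) := by
  unfold IsSOSOctic
  convert IsSOSOfDegree.add hg hh using 1
  simp only [symmetricOctic, add_div, map_add]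
  ring

theorem smul {c : ℝ} (hc : 0 ≤ c) (hg : IsSOSOctic g₀ g₂ g₃ g₄) :
    IsSOSOctic (c * g₀) (c * g₂) (c * g₃) (c * g₄) := by
  unfold IsSOSOctic
  convert IsSOSOfDegree.C_mul hc hg using 1
  simp only [symmetricOctic, mul_div_assoc, map_mul]
  ring

theorem of_eq {h₀ h₂ h₃ h₄ : ℝ} (hg : IsSOSOctic g₀ g₂ g₃ g₄) (e₀ : h₀ = g₀) (e₂ : h₂ = g₂)
    (e₃ : h₃ = g₃) (e₄ : h₄ = g₄) : IsSOSOctic h₀ h₂ h₃ h₄ := by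
  rwa [e₀, e₂, e₃, e₄]

theorem of_eval_eq {f : MvPolynomial (Fin 3) ℝ} (hf : IsSOSOfDegree 4 f)
    (h : ∀ x, eval x (symmetricOctic g₀ g₂ g₃ g₄) = eval x f) : IsSOSOctic g₀ g₂ g₃ g₄ := by
  unfold IsSOSOctic
  rwa [MvPolynomial.funext h]

end IsSOSOctic

theorem isHomogeneous_squareSpread : squareSpread.IsHomogeneous 4 := by
  have h4 : ∀ i, ((X i : MvPolynomial (Fin 3) ℝ) ^ 4).IsHomogeneous 4 :=
    fun i => isHomogeneous_X_pow i 4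
  have h22 : ∀ i j, ((X i : MvPolynomial (Fin 3) ℝ) ^ 2 * X j ^ 2).IsHomogeneous 4 :=
    fun i j => (isHomogeneous_X_pow i 2).mul (isHomogeneous_X_pow j 2)
  exact (((((h4 0).add (h4 1)).add (h4 2)).sub (h22 0 1)).sub (h22 1 2)).sub (h22 0 2)

theorem isHomogeneous_squareDeviation (i : Fin 3) : (squareDeviation i).IsHomogeneous 2 := by
  have : squareDeviation i = C 3 * X i ^ 2 - psum (Fin 3) ℝ 2 := by
    rw [squareDeviation, map_ofNat]
  rw [this]
  exact ((isHomogeneous_X_pow i 2).C_mul 3).sub (isHomogeneous_psum 3 2)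

theorem isSOSOctic_sq (l m : ℝ) : IsSOSOctic (l ^ 2) (2 * l * m) 0 (m ^ 2) := by
  refine IsSOSOctic.of_eval_eq (IsSOSOfDegree.sq (f := C l * psum (Fin 3) ℝ 2 ^ 2 +
    C m * squareSpread) ?_) fun x => ?_
  · exact (((isHomogeneous_psum 3 2).pow 2).C_mul l).add (isHomogeneous_squareSpread.C_mul m)
  · simp only [symmetricOctic, map_add, map_mul, map_pow, eval_C]
    ring

/-- On the curve of two equal squares this octic is `t² (t - w)²`: a double zero at the diagonal and
another at a prescribed parameter. -/
theorem isSOSOctic_dev (w : ℝ) : IsSOSOctic 0 (w ^ 2) (-2 * w) 1 := by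
  have hsq : ∀ i : Fin 3, IsSOSOfDegree 4 ((squareDeviation i ^ 2 - C 2 * squareSpread -
      C w * (psum (Fin 3) ℝ 2 * squareDeviation i)) ^ 2) := fun i =>
    IsSOSOfDegree.sq ((((isHomogeneous_squareDeviation i).pow 2).sub
      (isHomogeneous_squareSpread.C_mul 2)).sub
      (((isHomogeneous_psum 3 2).mul (isHomogeneous_squareDeviation i)).C_mul w))
  refine IsSOSOctic.of_eval_eq ((((hsq 0).add (hsq 1)).add (hsq 2)).C_mul
    (c := 1 / 6) (by norm_num)) fun x => ?_
  simp only [symmetricOctic, squareSpread, squareDeviation, map_add, map_sub, map_mul, map_pow,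
    eval_C, eval_X, eval_psum, Fin.sum_univ_three, map_ofNat]
  ring

theorem isSOSOfDegree_squareSpread : IsSOSOfDegree 2 squareSpread := by
  have hd : ∀ i j, IsSOSOfDegree 2 ((X i ^ 2 - X j ^ 2 : MvPolynomial (Fin 3) ℝ) ^ 2) :=
    fun i j => IsSOSOfDegree.sq ((isHomogeneous_X_pow i 2).sub (isHomogeneous_X_pow j 2))
  convert (((hd 0 1).add (hd 1 2)).add (hd 0 2)).C_mul (c := 1 / 2) (by norm_num) using 1
  refine MvPolynomial.funext fun x => ?_
  simp only [squareSpread, map_add, map_sub, map_mul, map_pow, eval_C, eval_X]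
  ring

theorem isSOSOctic_W : IsSOSOctic 0 1 0 0 := by
  refine IsSOSOctic.of_eval_eq ((IsSOSOfDegree.sq (isHomogeneous_psum 3 2)).mul
    isSOSOfDegree_squareSpread) fun x => ?_
  simp [symmetricOctic]

/-- The second elementary symmetric polynomial of the squares is a sum of squares. -/
theorem isSOSOfDegree_pairs : IsSOSOfDegree 2
    ((X 0 * X 1) ^ 2 + (X 1 * X 2) ^ 2 + (X 0 * X 2) ^ 2 : MvPolynomial (Fin 3) ℝ) := by
  have hp : ∀ i j, IsSOSOfDegree 2 ((X i * X j : MvPolynomial (Fin 3) ℝ) ^ 2) :=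
    fun i j => IsSOSOfDegree.sq ((isHomogeneous_X _ i).mul (isHomogeneous_X _ j))
  exact ((hp 0 1).add (hp 1 2)).add (hp 0 2)

theorem isSOSOctic_one_sub : IsSOSOctic 1 (-1) 0 0 := by
  refine IsSOSOctic.of_eval_eq (((IsSOSOfDegree.sq (isHomogeneous_psum 3 2)).mul
    isSOSOfDegree_pairs).C_mul (c := 3) (by norm_num)) fun x => ?_
  simp only [symmetricOctic, squareSpread, squareDeviation, map_add, map_sub, map_mul, map_pow,
    eval_C, eval_X, eval_psum, Fin.sum_univ_three, map_ofNat]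
  ring

theorem isSOSOctic_W_mul_one_sub : IsSOSOctic 0 1 0 (-1) := by
  refine IsSOSOctic.of_eval_eq ((isSOSOfDegree_squareSpread.mul
    isSOSOfDegree_pairs).C_mul (c := 3) (by norm_num)) fun x => ?_
  simp only [symmetricOctic, squareSpread, squareDeviation, map_add, map_sub, map_mul, map_pow,
    eval_C, eval_X, eval_psum, Fin.sum_univ_three, map_ofNat]
  ring

/-- `W - T` is `t² (1 - t)` on the curve of two equal squares; as a form it is a multiple of `S ∑ a
(b - c)²` in the squares `a, b, c`. -/
theorem isSOSOctic_schur : IsSOSOctic 0 1 (-1) 0 := by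
  have hp : ∀ i j k, IsSOSOfDegree 3 ((X i * (X j ^ 2 - X k ^ 2) : MvPolynomial (Fin 3) ℝ) ^ 2) :=
    fun i j k => IsSOSOfDegree.sq ((isHomogeneous_X _ i).mul
      ((isHomogeneous_X_pow j 2).sub (isHomogeneous_X_pow k 2)))
  refine IsSOSOctic.of_eval_eq (((isSOSOfDegree_psum_two (n := 3)).mul
    (((hp 0 1 2).add (hp 1 0 2)).add (hp 2 0 1))).C_mul (c := 3 / 2) (by norm_num)) fun x => ?_
  simp only [symmetricOctic, squareSpread, squareDeviation, map_add, map_sub, map_mul, map_pow,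
    eval_C, eval_X, eval_psum, Fin.sum_univ_three, map_ofNat]
  ring

/-- A multiple of `S a b c` in the squares: `(1 - t)² (1 + 2t)` on the curve of two equal squares,
and zero whenever a coordinate vanishes. Subtracting it leaves the values on that second curve
unchanged. -/
theorem isSOSOctic_prod : IsSOSOctic 1 (-3) 2 0 := by
  have hp : IsSOSOfDegree 3 ((X 0 * X 1 * X 2 : MvPolynomial (Fin 3) ℝ) ^ 2) :=
    IsSOSOfDegree.sq (((isHomogeneous_X _ 0).mul (isHomogeneous_X _ 1)).mul (isHomogeneous_X _ 2))
  refine IsSOSOctic.of_eval_eq (((isSOSOfDegree_psum_two (n := 3)).mul hp).C_mul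
    (c := 27) (by norm_num)) fun x => ?_
  simp only [symmetricOctic, squareSpread, squareDeviation, map_add, map_sub, map_mul, map_pow,
    eval_C, eval_X, eval_psum, Fin.sum_univ_three, map_ofNat]
  ring

/-- On the curve of two equal squares this is `t² (1 - t) (1 + 2t)`, with zeros at both ends `1` and
`-1/2`. -/
theorem isSOSOctic_pairs : IsSOSOctic 0 1 1 (-2) := by
  have hp : ∀ i j, IsSOSOfDegree 4 ((X i * X j * (X i ^ 2 - X j ^ 2) :
      MvPolynomial (Fin 3) ℝ) ^ 2) :=
    fun i j => IsSOSOfDegree.sq (((isHomogeneous_X _ i).mul (isHomogeneous_X _ j)).mul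
      ((isHomogeneous_X_pow i 2).sub (isHomogeneous_X_pow j 2)))
  refine IsSOSOctic.of_eval_eq ((((hp 0 1).add (hp 1 2)).add (hp 0 2)).C_mul
    (c := 9 / 2) (by norm_num)) fun x => ?_
  simp only [symmetricOctic, squareSpread, squareDeviation, map_add, map_sub, map_mul, map_pow,
    eval_C, eval_X, eval_psum, Fin.sum_univ_three, map_ofNat]
  ring

theorem isSOSOctic_W_mul_one_add : IsSOSOctic 0 1 2 0 :=
  ((isSOSOctic_pairs.smul (c := 2 / 3) (by norm_num)).add
    ((isSOSOctic_dev (-1 / 2)).smul (c := 4 / 3) (by norm_num))).of_eq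
      (by ring) (by ring) (by ring) (by ring)

section Cone

variable {g₀ g₂ g₃ g₄ : ℝ}

/-- A double zero at `ω` leaves two free parameters, and `(1 - W / ω²)²` together with
`isSOSOctic_dev ω` spans that plane. -/
theorem isSOSOctic_of_double_zero {ω : ℝ} (hω : ω ≠ 0) (h0 : 0 ≤ g₀) (h3 : 0 ≤ -g₃ / ω)
    (hz : g₀ + g₂ * ω ^ 2 + g₃ * ω ^ 3 + g₄ * ω ^ 4 = 0)
    (hd : 2 * g₂ * ω + 3 * g₃ * ω ^ 2 + 4 * g₄ * ω ^ 3 = 0) : IsSOSOctic g₀ g₂ g₃ g₄ := by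
  have hd' : 2 * g₂ + 3 * g₃ * ω + 4 * g₄ * ω ^ 2 = 0 := by
    apply mul_left_cancel₀ hω
    linear_combination hd
  refine (((isSOSOctic_sq 1 (-1 / ω ^ 2)).smul h0).add
    ((isSOSOctic_dev ω).smul (c := -g₃ / ω / 2) (by linarith))).of_eq (by ring) ?_ ?_ ?_
  · field_simp
    linear_combination 4 * hz - ω ^ 2 * hd'
  · field_simp
    ring
  · field_simp
    linear_combination -2 * hz + ω ^ 2 * hd'

theorem isSOSOctic_of_nonneg_of_cubic_eq_zero
    (h : ∀ x ∈ Set.Icc (0 : ℝ) 1, 0 ≤ g₀ + g₂ * x + g₄ * x ^ 2) : IsSOSOctic g₀ g₂ 0 g₄ := by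
  have h0 := h 0 (by norm_num)
  have h1 := h 1 (by norm_num)
  have hone : IsSOSOctic 1 0 0 0 := (isSOSOctic_sq 1 0).of_eq (by ring) (by ring) rfl (by ring)
  have hWW : IsSOSOctic 0 0 0 1 := (isSOSOctic_sq 0 1).of_eq (by ring) (by ring) rfl (by ring)
  norm_num at h0 h1
  rcases le_or_gt g₄ 0 with h4 | h4
  · exact (((isSOSOctic_W_mul_one_sub.smul (c := -g₄) (by linarith)).add
      (isSOSOctic_one_sub.smul h0)).add (isSOSOctic_W.smul h1)).of_eq
      (by ring) (by ring) (by ring) (by ring)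
  · rcases le_or_gt 0 g₂ with h2 | h2
    · exact (((hone.smul h0).add (isSOSOctic_W.smul h2)).add (hWW.smul h4.le)).of_eq
        (by ring) (by ring) (by ring) (by ring)
    · rcases le_or_gt (-g₂) (2 * g₄) with h5 | h5
      · have hv := h (-g₂ / (2 * g₄)) ⟨div_nonneg (by linarith) (by linarith),
          (div_le_one (by linarith)).2 h5⟩
        refine (((isSOSOctic_sq (-g₂ / (2 * g₄)) (-1)).smul h4.le).add (hone.smul hv)).of_eq
          ?_ ?_ ?_ ?_
        all_goals field_simp
        all_goals ring
      · exact ((((isSOSOctic_sq 1 (-1)).smul h4.le).add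
          (isSOSOctic_one_sub.smul (c := -g₂ - 2 * g₄) (by linarith))).add (hone.smul h1)).of_eq
          (by ring) (by ring) (by ring) (by ring)

/-- After removing `w²` the quartic is a quadratic on `[0, 1]`. The cases are: not convex, vertex
inside the interval (where `isSOSOctic_dev` vanishes), and vertex beyond 1. -/
theorem isSOSOctic_of_nonpos_of_const_eq_zero (h3 : g₃ ≤ 0)
    (h : ∀ w ∈ Set.Icc (0 : ℝ) 1, 0 ≤ g₂ + g₃ * w + g₄ * w ^ 2) : IsSOSOctic 0 g₂ g₃ g₄ := by
  have h1 := h 1 (by norm_num)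
  norm_num at h1
  rcases le_or_gt g₄ 0 with h4 | h4
  · exact (((isSOSOctic_W_mul_one_sub.smul (c := -g₄) (by linarith)).add
      (isSOSOctic_schur.smul (c := -g₃) (by linarith))).add (isSOSOctic_W.smul h1)).of_eq
      (by ring) (by ring) (by ring) (by ring)
  · rcases le_or_gt (-g₃) (2 * g₄) with h5 | h5
    · have hv := h (-g₃ / (2 * g₄)) ⟨div_nonneg (by linarith) (by linarith),
        (div_le_one (by linarith)).2 h5⟩
      refine (((isSOSOctic_dev (-g₃ / (2 * g₄))).smul h4.le).add (isSOSOctic_W.smul hv)).of_eq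
        ?_ ?_ ?_ ?_
      all_goals field_simp
      all_goals ring
    · exact ((((isSOSOctic_dev 1).smul h4.le).add
        (isSOSOctic_schur.smul (c := -g₃ - 2 * g₄) (by linarith))).add
        (isSOSOctic_W.smul h1)).of_eq (by ring) (by ring) (by ring) (by ring)

theorem isSOSOctic_of_nonpos_of_zero (h3 : g₃ ≤ 0)
    (h : ∀ w ∈ Set.Icc (0 : ℝ) 1, 0 ≤ g₀ + g₂ * w ^ 2 + g₃ * w ^ 3 + g₄ * w ^ 4) {w₀ : ℝ}
    (hw₀ : w₀ ∈ Set.Ico (0 : ℝ) 1) (hz : g₀ + g₂ * w₀ ^ 2 + g₃ * w₀ ^ 3 + g₄ * w₀ ^ 4 = 0) :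
    IsSOSOctic g₀ g₂ g₃ g₄ := by
  have h0 := h 0 (by norm_num)
  norm_num at h0
  rcases hw₀.1.eq_or_lt with rfl | hpos
  · have hg : g₀ = 0 := by simpa using hz
    subst hg
    exact isSOSOctic_of_nonpos_of_const_eq_zero h3
      (nonneg_of_forall_mul_sq_nonneg one_pos (by simpa only [zero_add] using h))
  · exact isSOSOctic_of_double_zero hpos.ne' h0 (div_nonneg (by linarith) hpos.le) hz
      (quartic_deriv_eq_zero ⟨hpos, hw₀.2⟩ h hz)

/-- A zero at the end point 1 need not be double. Subtract the largest multiple of `1 - W = (1 - w)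
(1 + w)`: then either a zero appears in `[0, 1)`, or the zero at 1 becomes double. -/
theorem isSOSOctic_of_nonpos_of_zero_at_one (h3 : g₃ ≤ 0)
    (h : ∀ w ∈ Set.Icc (0 : ℝ) 1, 0 ≤ g₀ + g₂ * w ^ 2 + g₃ * w ^ 3 + g₄ * w ^ 4)
    (hz : g₀ + g₂ + g₃ + g₄ = 0) : IsSOSOctic g₀ g₂ g₃ g₄ := by
  have hfac : ∀ w : ℝ, g₀ + g₂ * w ^ 2 + g₃ * w ^ 3 + g₄ * w ^ 4 =
      (1 - w) * (g₀ + g₀ * w + (g₀ + g₂) * w ^ 2 - g₄ * w ^ 3) := fun w => by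
    linear_combination w ^ 3 * hz
  obtain ⟨c, w₀, hw₀, hle, heq⟩ := exists_mul_le_of_continuous (a := 0) (b := 1) zero_le_one
    (h := fun w => g₀ + g₀ * w + (g₀ + g₂) * w ^ 2 - g₄ * w ^ 3) (q := fun w => 1 + w)
    (by fun_prop) (by fun_prop) (fun w hw => by linarith [hw.1])
  have hc : 0 ≤ c := by
    have hcl : IsClosed {w : ℝ | 0 ≤ g₀ + g₀ * w + (g₀ + g₂) * w ^ 2 - g₄ * w ^ 3} :=
      isClosed_le continuous_const (by fun_prop)
    have hsub : Set.Ico (0 : ℝ) 1 ⊆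
        {w : ℝ | 0 ≤ g₀ + g₀ * w + (g₀ + g₂) * w ^ 2 - g₄ * w ^ 3} := by
      intro w hw
      have h1 := h w ⟨hw.1, hw.2.le⟩
      rw [hfac] at h1
      exact nonneg_of_mul_nonneg_right h1 (by linarith [hw.2])
    have h2 := closure_minimal hsub hcl
    rw [closure_Ico zero_ne_one] at h2
    have h4 := h2 hw₀
    simp only [Set.mem_ofPred_eq] at h4 heq
    rw [← heq] at h4
    exact nonneg_of_mul_nonneg_left h4 (by linarith [hw₀.1])
  have h' : ∀ w ∈ Set.Icc (0 : ℝ) 1,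
      0 ≤ (g₀ - c) + (g₂ + c) * w ^ 2 + g₃ * w ^ 3 + g₄ * w ^ 4 := by
    intro w hw
    have h1 := mul_nonneg (sub_nonneg.2 hw.2) (sub_nonneg.2 (hle w hw))
    have h2 := hfac w
    nlinarith
  have key : IsSOSOctic (g₀ - c) (g₂ + c) g₃ g₄ := by
    rcases hw₀.2.lt_or_eq with hlt | rfl
    · refine isSOSOctic_of_nonpos_of_zero h3 h' ⟨hw₀.1, hlt⟩ ?_
      linear_combination hfac w₀ - (1 - w₀) * heq
    · have h0 := h' 0 (by norm_num)
      norm_num at h0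
      refine isSOSOctic_of_double_zero one_ne_zero (by linarith) (by linarith) ?_ ?_
      · linear_combination hz
      · linear_combination heq + 3 * hz
  exact (key.add (isSOSOctic_one_sub.smul hc)).of_eq (by ring) (by ring) (by ring) (by ring)

theorem isSOSOctic_of_nonpos (h3 : g₃ ≤ 0)
    (h : ∀ w ∈ Set.Icc (0 : ℝ) 1, 0 ≤ g₀ + g₂ * w ^ 2 + g₃ * w ^ 3 + g₄ * w ^ 4) :
    IsSOSOctic g₀ g₂ g₃ g₄ := by
  obtain ⟨c, w₀, hw₀, hle, heq⟩ := exists_mul_le_of_continuous (a := 0) (b := 1) zero_le_one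
    (h := fun w => g₀ + g₂ * w ^ 2 + g₃ * w ^ 3 + g₄ * w ^ 4) (q := fun _ => 1)
    (by fun_prop) (by fun_prop) (fun w hw => one_pos)
  simp only [mul_one] at hle heq
  have hc : 0 ≤ c := heq ▸ h w₀ hw₀
  have h' : ∀ w ∈ Set.Icc (0 : ℝ) 1,
      0 ≤ (g₀ - c) + g₂ * w ^ 2 + g₃ * w ^ 3 + g₄ * w ^ 4 := fun w hw => by
    linarith [hle w hw]
  have key : IsSOSOctic (g₀ - c) g₂ g₃ g₄ := by
    rcases hw₀.2.lt_or_eq with hlt | rfl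
    · exact isSOSOctic_of_nonpos_of_zero h3 h' ⟨hw₀.1, hlt⟩ (by linarith)
    · exact isSOSOctic_of_nonpos_of_zero_at_one h3 h' (by linarith)
  exact (key.add ((isSOSOctic_sq 1 0).smul hc)).of_eq (by ring) (by ring) (by ring) (by ring)

/-- The same argument for the branch `t = -w`, with end point `t = -1/2`. When `g₄` is very
negative, the binding constraint is instead the value at a coordinate vector, `hA`. -/
theorem isSOSOctic_of_nonneg_of_const_eq_zero (h3 : 0 ≤ g₃)
    (h : ∀ w ∈ Set.Icc (0 : ℝ) (1 / 2), 0 ≤ g₂ + (-g₃) * w + g₄ * w ^ 2)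
    (hA : 0 ≤ g₂ + g₃ + g₄) : IsSOSOctic 0 g₂ g₃ g₄ := by
  have h1 := h (1 / 2) (by norm_num)
  rcases le_or_gt 0 g₄ with h4 | h4
  · rcases le_or_gt g₃ g₄ with h5 | h5
    · rcases h4.eq_or_lt with rfl | h4
      · obtain rfl : g₃ = 0 := le_antisymm h5 h3
        exact (isSOSOctic_W.smul (c := g₂) (by linarith)).of_eq
          (by ring) (by ring) (by ring) (by ring)
      · have hv := h (g₃ / (2 * g₄)) ⟨by positivity, by
          rw [div_le_iff₀ (by linarith)]; linarith⟩
        refine (((isSOSOctic_dev (-g₃ / (2 * g₄))).smul h4.le).add (isSOSOctic_W.smul hv)).of_eq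
          ?_ ?_ ?_ ?_
        all_goals field_simp
        all_goals ring
    · exact ((((isSOSOctic_dev (-1 / 2)).smul h4).add
        (isSOSOctic_W_mul_one_add.smul (c := g₃ / 2 - g₄ / 2) (by linarith))).add
        (isSOSOctic_W.smul h1)).of_eq (by ring) (by ring) (by ring) (by ring)
  · rcases le_or_gt (-g₄) (2 * g₃) with h5 | h5
    · exact (((isSOSOctic_pairs.smul (c := -g₄ / 2) (by linarith)).add
        (isSOSOctic_W_mul_one_add.smul (c := g₃ / 2 + g₄ / 4) (by linarith))).add
        (isSOSOctic_W.smul h1)).of_eq (by ring) (by ring) (by ring) (by ring)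
    · exact (((isSOSOctic_pairs.smul h3).add
        (isSOSOctic_W_mul_one_sub.smul (c := -g₄ - 2 * g₃) (by linarith))).add
        (isSOSOctic_W.smul hA)).of_eq (by ring) (by ring) (by ring) (by ring)

theorem isSOSOctic_of_nonneg_of_zero (h3 : 0 ≤ g₃)
    (h : ∀ w ∈ Set.Icc (0 : ℝ) (1 / 2), 0 ≤ g₀ + g₂ * w ^ 2 + (-g₃) * w ^ 3 + g₄ * w ^ 4)
    (hA : 0 ≤ g₀ + g₂ + g₃ + g₄) {w₀ : ℝ} (hw₀ : w₀ ∈ Set.Icc (0 : ℝ) (1 / 2))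
    (hz : g₀ + g₂ * w₀ ^ 2 + (-g₃) * w₀ ^ 3 + g₄ * w₀ ^ 4 = 0)
    (hd : w₀ = 1 / 2 → 2 * g₂ * w₀ + 3 * (-g₃) * w₀ ^ 2 + 4 * g₄ * w₀ ^ 3 = 0) :
    IsSOSOctic g₀ g₂ g₃ g₄ := by
  have h0 := h 0 (by norm_num)
  norm_num at h0
  rcases hw₀.1.eq_or_lt with rfl | hpos
  · have hg : g₀ = 0 := by simpa using hz
    subst hg
    exact isSOSOctic_of_nonneg_of_const_eq_zero h3
      (nonneg_of_forall_mul_sq_nonneg (by norm_num) (by simpa only [zero_add] using h))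
      (by linarith)
  · have hd' : 2 * g₂ * w₀ + 3 * (-g₃) * w₀ ^ 2 + 4 * g₄ * w₀ ^ 3 = 0 := by
      rcases hw₀.2.lt_or_eq with hlt | heq
      · exact quartic_deriv_eq_zero ⟨hpos, hlt⟩ h hz
      · exact hd heq
    refine isSOSOctic_of_double_zero (ω := -w₀) (neg_ne_zero.2 hpos.ne') h0 ?_ ?_ ?_
    · rw [neg_div_neg_eq]
      exact div_nonneg h3 hpos.le
    · linear_combination hz
    · linear_combination -hd'

/-- Subtract multiples of `isSOSOctic_prod`, which lowers `g₃` twice as fast as `c` grows. Either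
the quartic touches zero while `g₃` is still non-negative, or `g₃` reaches 0 first and a quadratic
in `W` on `[0, 1]` remains: `hA` covers `W ≥ 1/4` and `w = √W` covers the rest. The condition `hd`
supplies the derivative at the end point `1/2`, where minimality alone does not. -/
theorem isSOSOctic_of_touch (h3 : 0 ≤ g₃)
    (hA : ∀ x ∈ Set.Icc (1 / 4 : ℝ) 1,
      0 ≤ (g₀ - g₃ / 2) + (g₂ + 3 * g₃ / 2) * x + g₄ * x ^ 2) {c : ℝ} (hc : 0 ≤ c)
    (hle : ∀ w ∈ Set.Icc (0 : ℝ) (1 / 2), c * ((1 + w) ^ 2 * (1 - 2 * w)) ≤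
      g₀ + g₂ * w ^ 2 + (-g₃) * w ^ 3 + g₄ * w ^ 4) {w₀ : ℝ}
    (hw₀ : w₀ ∈ Set.Icc (0 : ℝ) (1 / 2))
    (hz : c * ((1 + w₀) ^ 2 * (1 - 2 * w₀)) =
      g₀ + g₂ * w₀ ^ 2 + (-g₃) * w₀ ^ 3 + g₄ * w₀ ^ 4)
    (hd : w₀ = 1 / 2 → 8 * g₂ - 6 * g₃ + 4 * g₄ + 36 * c = 0) :
    IsSOSOctic g₀ g₂ g₃ g₄ := by
  rcases le_or_gt (2 * c) g₃ with hcg | hcg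
  · have key : IsSOSOctic (g₀ - c) (g₂ + 3 * c) (g₃ - 2 * c) g₄ := by
      refine isSOSOctic_of_nonneg_of_zero (by linarith) (fun w hw => ?_) ?_ hw₀ ?_ ?_
      · linarith [hle w hw]
      · linarith [hA 1 (by norm_num)]
      · linear_combination -hz
      · intro h
        have := hd h
        subst h
        linear_combination this / 8
    exact (key.add (isSOSOctic_prod.smul hc)).of_eq (by ring) (by ring) (by ring) (by ring)
  · have key : IsSOSOctic (g₀ - g₃ / 2) (g₂ + 3 * g₃ / 2) 0 g₄ := by
      refine isSOSOctic_of_nonneg_of_cubic_eq_zero fun x hx => ?_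
      rcases le_or_gt (1 / 4) x with h4 | h4
      · exact hA x ⟨h4, hx.2⟩
      · have hs : Real.sqrt x ≤ 1 / 2 := Real.sqrt_le_iff.2 ⟨by norm_num, by linarith⟩
        have h1 := hle (Real.sqrt x) ⟨Real.sqrt_nonneg x, hs⟩
        have h2 := Real.sq_sqrt hx.1
        have h5 : 0 ≤ (c - g₃ / 2) * ((1 + Real.sqrt x) ^ 2 * (1 - 2 * Real.sqrt x)) :=
          mul_nonneg (by linarith) (mul_nonneg (sq_nonneg _) (by linarith))
        generalize Real.sqrt x = s at *
        subst h2
        linarith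
    exact (key.add (isSOSOctic_prod.smul (c := g₃ / 2) (by linarith))).of_eq
      (by ring) (by ring) (by ring) (by ring)

theorem isSOSOctic_of_nonneg (h3 : 0 ≤ g₃)
    (h : ∀ w ∈ Set.Icc (0 : ℝ) (1 / 2), 0 ≤ g₀ + g₂ * w ^ 2 + (-g₃) * w ^ 3 + g₄ * w ^ 4)
    (hA : ∀ x ∈ Set.Icc (1 / 4 : ℝ) 1,
      0 ≤ (g₀ - g₃ / 2) + (g₂ + 3 * g₃ / 2) * x + g₄ * x ^ 2) : IsSOSOctic g₀ g₂ g₃ g₄ := by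
  by_cases hex : ∃ w₀ ∈ Set.Ico (0 : ℝ) (1 / 2),
      g₀ + g₂ * w₀ ^ 2 + (-g₃) * w₀ ^ 3 + g₄ * w₀ ^ 4 = 0
  · obtain ⟨w₀, hw₀, hz⟩ := hex
    exact isSOSOctic_of_nonneg_of_zero h3 h (by linarith [hA 1 (by norm_num)])
      ⟨hw₀.1, hw₀.2.le⟩ hz fun h' => absurd h' hw₀.2.ne
  push Not at hex
  have hpos : ∀ w ∈ Set.Ico (0 : ℝ) (1 / 2),
      0 < g₀ + g₂ * w ^ 2 + (-g₃) * w ^ 3 + g₄ * w ^ 4 := fun w hw =>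
    lt_of_le_of_ne (h w ⟨hw.1, hw.2.le⟩) (hex w hw).symm
  by_cases hhalf : g₀ + g₂ * (1 / 2) ^ 2 + (-g₃) * (1 / 2) ^ 3 + g₄ * (1 / 2) ^ 4 = 0
  -- Both the quartic and `isSOSOctic_prod` vanish at `1/2`; dividing both by `1 - 2w` makes the
  -- comparison function positive on the whole interval.
  · have hfac : ∀ w : ℝ, g₀ + g₂ * w ^ 2 + (-g₃) * w ^ 3 + g₄ * w ^ 4 =
        (1 - 2 * w) * (g₀ + 2 * g₀ * w + (4 * g₀ + g₂) * w ^ 2 - g₄ / 2 * w ^ 3) := fun w => by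
      linear_combination 8 * w ^ 3 * hhalf
    obtain ⟨c, w₀, hw₀, hle, heq⟩ := exists_mul_le_of_continuous (a := 0) (b := 1 / 2)
      (by norm_num) (h := fun w => g₀ + 2 * g₀ * w + (4 * g₀ + g₂) * w ^ 2 - g₄ / 2 * w ^ 3)
      (q := fun w => (1 + w) ^ 2) (by fun_prop) (by fun_prop) (fun w hw => by
        have := hw.1
        positivity)
    have hc : 0 ≤ c := by
      have hcl : IsClosed {w : ℝ | 0 ≤ g₀ + 2 * g₀ * w + (4 * g₀ + g₂) * w ^ 2 -
        g₄ / 2 * w ^ 3} := isClosed_le continuous_const (by fun_prop)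
      have hsub : Set.Ico (0 : ℝ) (1 / 2) ⊆ {w : ℝ | 0 ≤ g₀ + 2 * g₀ * w +
          (4 * g₀ + g₂) * w ^ 2 - g₄ / 2 * w ^ 3} := by
        intro w hw
        have h1 := h w ⟨hw.1, hw.2.le⟩
        rw [hfac] at h1
        exact nonneg_of_mul_nonneg_right h1 (by linarith [hw.2])
      have h2 := closure_minimal hsub hcl
      rw [closure_Ico (by norm_num)] at h2
      have h4 := h2 hw₀
      simp only [Set.mem_ofPred_eq] at h4
      rw [← heq] at h4
      have hw1 := hw₀.1
      exact nonneg_of_mul_nonneg_left h4 (by positivity)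
    refine isSOSOctic_of_touch h3 hA hc (fun w hw => ?_) hw₀ ?_ ?_
    · rw [hfac, ← mul_assoc, mul_comm]
      exact mul_le_mul_of_nonneg_left (hle w hw) (by linarith [hw.2])
    · rw [hfac, ← heq]
      ring
    · intro h'
      subst h'
      linear_combination 16 * heq + 48 * hhalf
  · have hpos' : ∀ w ∈ Set.Icc (0 : ℝ) (1 / 2),
        0 < g₀ + g₂ * w ^ 2 + (-g₃) * w ^ 3 + g₄ * w ^ 4 := by
      intro w hw
      rcases hw.2.lt_or_eq with hlt | rfl
      · exact hpos w ⟨hw.1, hlt⟩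
      · exact lt_of_le_of_ne (h _ hw) (Ne.symm hhalf)
    -- `isSOSOctic_prod` vanishes at `1/2`, so the quotient is taken the other way round and the
    -- wanted multiple is `-c⁻¹`.
    obtain ⟨c, w₀, hw₀, hle, heq⟩ := exists_mul_le_of_continuous (a := 0) (b := 1 / 2)
      (by norm_num) (h := fun w => -((1 + w) ^ 2 * (1 - 2 * w)))
      (q := fun w => g₀ + g₂ * w ^ 2 + (-g₃) * w ^ 3 + g₄ * w ^ 4)
      (by fun_prop) (by fun_prop) hpos'
    have hc : c < 0 := by
      have h1 := hle 0 (by norm_num)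
      have h2 := hpos' 0 (by norm_num)
      by_contra hcon
      have := mul_nonneg (not_lt.1 hcon) h2.le
      norm_num at h1 this
      linarith
    refine isSOSOctic_of_touch h3 hA (c := -c⁻¹) (by
      rw [neg_nonneg]; exact inv_nonpos.2 hc.le) (fun w hw => ?_) hw₀ ?_ ?_
    · have h1 := mul_le_mul_of_nonpos_left (hle w hw) (inv_nonpos.2 hc.le)
      rw [← mul_assoc, inv_mul_cancel₀ hc.ne, one_mul] at h1
      linarith
    · have h1 := congrArg (fun t => c⁻¹ * t) heq
      rw [← mul_assoc, inv_mul_cancel₀ hc.ne, one_mul] at h1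
      linarith
    · intro h'
      subst h'
      exfalso
      have h1 := hpos' (1 / 2) (by norm_num)
      rw [show (-((1 + 1 / 2 : ℝ) ^ 2 * (1 - 2 * (1 / 2)))) = 0 by norm_num] at heq
      exact (mul_neg_of_neg_of_pos hc h1).ne heq

end Cone

theorem isSOSOctic_of_isNonnegative {g₀ g₂ g₃ g₄ : ℝ}
    (h : IsNonnegative (symmetricOctic g₀ g₂ g₃ g₄)) : IsSOSOctic g₀ g₂ g₃ g₄ := by
  have hG : ∀ w ∈ Set.Icc (-1 / 2 : ℝ) 1, 0 ≤ g₀ + g₂ * w ^ 2 + g₃ * w ^ 3 + g₄ * w ^ 4 := by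
    intro w hw
    have h1 := Real.sq_sqrt (show (0 : ℝ) ≤ 1 - w by linarith [hw.2])
    have h2 := Real.sq_sqrt (show (0 : ℝ) ≤ 1 + 2 * w by linarith [hw.1])
    -- Squares `1 - w, 1 - w, 1 + 2w`: then `S = 3`, and the octic is 81 times the quartic in `w`.
    have h3 := h ![Real.sqrt (1 - w), Real.sqrt (1 - w), Real.sqrt (1 + 2 * w)]
    rw [eval_symmetricOctic] at h3
    simp only [Matrix.cons_val] at h3
    simp only [show ∀ t : ℝ, t ^ 8 = (t ^ 2) ^ 4 from fun t => by ring,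
      show ∀ t : ℝ, t ^ 6 = (t ^ 2) ^ 3 from fun t => by ring,
      show ∀ t : ℝ, t ^ 4 = (t ^ 2) ^ 2 from fun t => by ring, h1, h2] at h3
    linarith
  have hA : ∀ x ∈ Set.Icc (1 / 4 : ℝ) 1,
      0 ≤ (g₀ - g₃ / 2) + (g₂ + 3 * g₃ / 2) * x + g₄ * x ^ 2 := by
    intro x hx
    obtain ⟨m, hm0, hm1, rfl⟩ : ∃ m : ℝ, 0 ≤ m ∧ m ≤ 1 ∧ x = (1 + 3 * m ^ 2) / 4 :=
      ⟨Real.sqrt ((4 * x - 1) / 3), Real.sqrt_nonneg _,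
        Real.sqrt_le_one.2 (by linarith [hx.2]), by
        rw [Real.sq_sqrt (by linarith [hx.1])]; ring⟩
    have h1 := Real.sq_sqrt (show (0 : ℝ) ≤ 1 - m by linarith)
    have h2 := Real.sq_sqrt (show (0 : ℝ) ≤ 1 + m by linarith)
    -- Squares `1 - m, 1 + m, 0`: then `S = 2` and `W / S² = (1 + 3m²) / 4 = x`.
    have h3 := h ![Real.sqrt (1 - m), Real.sqrt (1 + m), 0]
    rw [eval_symmetricOctic] at h3
    simp only [Matrix.cons_val] at h3
    simp only [show ∀ t : ℝ, t ^ 8 = (t ^ 2) ^ 4 from fun t => by ring,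
      show ∀ t : ℝ, t ^ 6 = (t ^ 2) ^ 3 from fun t => by ring,
      show ∀ t : ℝ, t ^ 4 = (t ^ 2) ^ 2 from fun t => by ring, h1, h2] at h3
    linarith
  rcases le_or_gt g₃ 0 with h3 | h3
  · exact isSOSOctic_of_nonpos h3 fun w hw => hG w ⟨by linarith [hw.1], hw.2⟩
  · refine isSOSOctic_of_nonneg h3.le (fun w hw => ?_) hA
    have := hG (-w) ⟨by linarith [hw.2], by linarith [hw.1]⟩
    linarith

/-! ### Every invariant ternary octic belongs to the four-parameter family. -/

/-- The exponent vector `(a, b, c)` of a monomial in three variables. -/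
noncomputable def exponentTriple (a b c : ℕ) : Fin 3 →₀ ℕ :=
  Finsupp.equivFunOnFinite.symm ![a, b, c]

theorem exponentTriple_self (m : Fin 3 →₀ ℕ) : exponentTriple (m 0) (m 1) (m 2) = m := by
  ext i
  fin_cases i <;> rfl

section Octic

variable {f : MvPolynomial (Fin 3) ℝ}

theorem IsInvariantUnder.coeff_exponentTriple_swap₀₁
    (hf : IsInvariantUnder (reflectionGroupD 3) f) (a b c : ℕ) :
    coeff (exponentTriple a b c) f = coeff (exponentTriple b a c) f := by
  rw [← hf.coeff_perm (Equiv.swap 0 1) (exponentTriple a b c)]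
  congr 1
  ext i
  rw [Finsupp.mapDomain_equiv_apply, Equiv.symm_swap]
  fin_cases i <;> rfl

theorem IsInvariantUnder.coeff_exponentTriple_swap₁₂
    (hf : IsInvariantUnder (reflectionGroupD 3) f) (a b c : ℕ) :
    coeff (exponentTriple a b c) f = coeff (exponentTriple a c b) f := by
  rw [← hf.coeff_perm (Equiv.swap 1 2) (exponentTriple a b c)]
  congr 1
  ext i
  rw [Finsupp.mapDomain_equiv_apply, Equiv.symm_swap]
  fin_cases i <;> rfl

theorem IsInvariantUnder.eval_octic (hf : IsInvariantUnder (reflectionGroupD 3) f)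
    (hh : f.IsHomogeneous 8) (x : Fin 3 → ℝ) :
    eval x f = ∑ u ∈ Finset.range 5, ∑ v ∈ Finset.range (5 - u),
      coeff (exponentTriple (2 * u) (2 * v) (8 - 2 * u - 2 * v)) f *
        (x 0 ^ (2 * u) * x 1 ^ (2 * v) * x 2 ^ (8 - 2 * u - 2 * v)) := by
  classical
  have hsupp : ∀ m ∈ f.support, ∃ u v : ℕ, u < 5 ∧ v < 5 - u ∧
      m 0 = 2 * u ∧ m 1 = 2 * v ∧ m 2 = 8 - 2 * u - 2 * v := by
    intro m hm
    have hs := hh.sum_eq_of_mem_support hm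
    rw [Fin.sum_univ_three] at hs
    rcases hf.even_or_odd (mem_support_iff.1 hm) with he | ho
    · obtain ⟨u, hu⟩ := he 0
      obtain ⟨v, hv⟩ := he 1
      exact ⟨u, v, by omega, by omega, by omega, by omega, by omega⟩
    · obtain ⟨u, hu⟩ := ho 0
      obtain ⟨v, hv⟩ := ho 1
      obtain ⟨w, hw⟩ := ho 2
      omega
  rw [eval_eq', Finset.sum_sigma']
  refine Finset.sum_of_injOn (fun m => (⟨m 0 / 2, m 1 / 2⟩ : Σ _ : ℕ, ℕ)) ?_ ?_ ?_ ?_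
  · intro m hm m' hm' hmm
    obtain ⟨u, v, hu, hv, h0, h1, h2⟩ := hsupp m hm
    obtain ⟨u', v', hu', hv', h0', h1', h2'⟩ := hsupp m' hm'
    simp only [Sigma.mk.injEq, heq_eq_eq] at hmm
    obtain rfl : u = u' := by omega
    obtain rfl : v = v' := by omega
    rw [← exponentTriple_self m, ← exponentTriple_self m', h0, h1, h2, h0', h1', h2']
  · intro m hm
    obtain ⟨u, v, hu, hv, h0, h1, h2⟩ := hsupp m hm
    simp only [Finset.coe_sigma, Set.mem_sigma_iff, Finset.coe_range, Set.mem_Iio, h0, h1]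
    omega
  · rintro ⟨u, v⟩ huv hnot
    simp only [Finset.mem_sigma, Finset.mem_range] at huv
    by_cases hm : coeff (exponentTriple (2 * u) (2 * v) (8 - 2 * u - 2 * v)) f = 0
    · rw [hm, zero_mul]
    · refine absurd ⟨_, mem_support_iff.2 hm, ?_⟩ hnot
      simp [exponentTriple]
  · intro m hm
    obtain ⟨u, v, hu, hv, h0, h1, h2⟩ := hsupp m hm
    have hm' := exponentTriple_self m
    rw [h0, h1, h2] at hm'
    simp only [Fin.prod_univ_three, h0, h1, h2, Nat.mul_div_cancel_left _ two_pos, hm']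

theorem IsInvariantUnder.exists_eq_symmetricOctic
    (hf : IsInvariantUnder (reflectionGroupD 3) f) (hh : f.IsHomogeneous 8) :
    ∃ g₀ g₂ g₃ g₄ : ℝ, f = symmetricOctic g₀ g₂ g₃ g₄ := by
  set A₁ := coeff (exponentTriple 8 0 0) f with h₁
  set A₂ := coeff (exponentTriple 6 2 0) f with h₂
  set A₃ := coeff (exponentTriple 4 4 0) f with h₃
  set A₄ := coeff (exponentTriple 4 2 2) f with h₄
  -- Solves the triangular-looking system given by the four coefficients in `eval_symmetricOctic`;
  -- `g₀` is the value at `(1, 1, 1)` divided by `3⁴`.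
  set g₀ := (A₁ + 2 * A₂ + A₃ + A₄) / 27 with hg₀
  set g₂ := (A₁ - g₀ - 2 * ((A₄ - 12 * g₀) / 3) - (A₃ - 6 * g₀) / 3) / 3 with hg₂
  refine ⟨g₀, g₂, g₂ + (A₄ - 12 * g₀) / 3,
    g₂ + (A₄ - 12 * g₀) / 3 + (A₃ - 6 * g₀) / 3, MvPolynomial.funext fun x => ?_⟩
  have s₁ := hf.coeff_exponentTriple_swap₀₁
  have s₂ := hf.coeff_exponentTriple_swap₁₂
  rw [hf.eval_octic hh, eval_symmetricOctic]
  simp only [Finset.sum_range_succ, Finset.sum_range_zero, Nat.reduceSub, Nat.reduceMul, zero_add,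
    s₁ 0 8 0, s₂ 0 0 8, s₁ 2 6 0, s₂ 2 0 6, s₂ 6 0 2, s₁ 0 6 2, s₂ 0 2 6, s₂ 4 0 4, s₁ 0 4 4,
    s₁ 2 4 2, s₂ 2 2 4, ← h₁, ← h₂, ← h₃, ← h₄]
  simp only [hg₂, hg₀]
  ring

theorem isSOSOfDegree_of_ternary_octic (hf : IsInvariantUnder (reflectionGroupD 3) f)
    (hh : f.IsHomogeneous 8) (hnn : IsNonnegative f) : IsSOSOfDegree 4 f := by
  obtain ⟨g₀, g₂, g₃, g₄, rfl⟩ := hf.exists_eq_symmetricOctic hh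
  exact isSOSOctic_of_isNonnegative hnn

end Octic

/-! ### The classification. -/

theorem isSOSOfDegree_of_mem_invariantNonnegCone {n d : ℕ} (hn : 1 ≤ n)
    (h : n ≤ 2 ∨ 2 * d = 2 ∨ 2 * d = 4 ∨ (n = 3 ∧ 2 * d = 8)) {f : MvPolynomial (Fin n) ℝ}
    (hf : f ∈ invariantNonnegCone n (2 * d) (reflectionGroupD n)) : IsSOSOfDegree d f := by
  obtain ⟨hh, hi, hnn⟩ := hf
  by_cases hn1 : n = 1
  · subst hn1
    exact isSOSOfDegree_of_unary hh hnn
  by_cases hn2 : n = 2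
  · subst hn2
    exact isSOSOfDegree_of_binary hh hnn
  have hn3 : 3 ≤ n := by omega
  rcases h with h | h | h | ⟨rfl, h⟩
  · omega
  · obtain rfl : d = 1 := by omega
    exact isSOSOfDegree_of_quadratic hn3 hi hh hnn
  · obtain rfl : d = 2 := by omega
    exact isSOSOfDegree_of_quartic hn3 hi hh hnn
  · obtain rfl : d = 4 := by omega
    exact isSOSOfDegree_of_ternary_octic hi hh hnn

theorem mainTheorem6 (n d : ℕ) (hn : 1 ≤ n) (hd : 1 ≤ d) :
    invariantSOSCone n (2 * d) (reflectionGroupD n) =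
        invariantNonnegCone n (2 * d) (reflectionGroupD n) ↔
      n ≤ 2 ∨ 2 * d = 2 ∨ 2 * d = 4 ∨ (n = 3 ∧ 2 * d = 8) := by
  constructor
  · intro h
    by_contra hcon
    obtain ⟨f, hf, hns⟩ := hasNonnegNotSOS (n := n) (d := d) (by omega) (by omega) (by omega)
    have hs := hf
    rw [← h] at hs
    exact hns (IsSOSOfDegree.of_isSumOfSquaresOfForms hs.1 hs.2.2)
  · intro h
    ext f
    constructor
    · rintro ⟨hh, hi, hs⟩
      exact ⟨hh, hi, (IsSOSOfDegree.of_isSumOfSquaresOfForms hh hs).eval_nonneg⟩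
    · intro hf
      exact ⟨hf.1, hf.2.1,
        (isSOSOfDegree_of_mem_invariantNonnegCone hn h hf).isSumOfSquaresOfForms⟩
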